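/- A weight is a nonnegative locally integrable function on $\mathbb{R}$; for a weight $w$ put $w(E)=\int_E w$ and $L^p(w)=L^p(\mathbb{R},w\,dx)$. Let $M^+f(x)=\sup_{h>0}\frac1h\int_x^{x+h}|f|$. A Young function is a continuous convex function $\Phi:[0,\infty)\to[0,\infty)$ with $\Phi(0)=0$; its inverse is $\Phi^{-1}(t)=\inf\{s\ge 0:\Phi(s)>t\}$ (with $\inf\emptyset=\infty$). For an interval $I$ let $$\|f\|_{\Phi,I}=\inf\Big\{\lambda>0:\ \frac1{|I|}\int_I\Phi\Big(\frac{|f|}{\lambda}\Big)\,dx\le 1\Big\},\qquad M_\Phi^+f(x)=\sup_{h>0}\|f\|_{\Phi,(x,x+h)}.$$ For $p>1$, $p'=\frac{p}{p-1}$ and weights $w,\sigma$ define $$[\sigma,\Phi]_{W_p^-}=\sup_I\frac1{\sigma(I)}\int_I M_\Phi^+\big(\sigma^{1/p}\chi_I\big)^p\,dx,\qquad [w,\sigma,\Phi]_{A_p^+}=\sup_{a<b<c}\frac{w(a,b)}{c-a}\,\big\|\sigma^{1/p'}\chi_{(b,c)}\big\|_{\Phi,(a,c)}^p,$$ the first supremum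 being over bounded open intervals $I$ (quotients $0/0$ and products $0\cdot\infty$ are read as $0$). **Theorem.** Let $p>1$. (i) For every $\kappa\ge 0$ there is a constant $C$, depending only on $p$ and $\kappa$, such that for all Young functions $\Phi,\overline\Phi$ with $\Phi^{-1}(t)\,\overline\Phi^{-1}(t)\le\kappa t$ for every $t>0$, all weights $w,\sigma$ and all measurable $f$, $$\|M^+(f\sigma)\|_{L^p(w)}\le C\,\big([\sigma,\overline\Phi]_{W_p^-}\,[w,\sigma,\Phi]_{A_p^+}\big)^{1/p}\,\|f\|_{L^p(\sigma)}.$$ (ii) Consequently, there is a constant $c_p$, depending only on $p$, such that for every weight $w>0$ a.e. with $$[w]_{A_p^+}=\sup_{a<b<c}\frac1{c-a}\int_a^b w\,\Big(\frac1{c-a}\int_b^c w^{-\frac1{p-1}}\Big)^{p-1}<\infty,$$ and with $\sigma=w^{-\frac1{p-1}}$ and $[\sigma]_{A_\infty^-}=\sup_{a<b}\frac1{\sigma(a,b)}\int_a^b M^+(\sigma\chi_{(a,b)})$, all measurable $f$ satisfy $$\|M^+f\|_{L^p(w)}\le c_p\,\big([w]_{A_p^+}[\sigma]_{A_\infty^-}\big)^{1/p}\,\|f\|_{L^p(w)}.$$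 -/

import Mathlib

open MeasureTheory Set
open scoped NNReal ENNReal

noncomputable section

/-- A weight: a nonnegative, locally integrable function on the real line. -/
def IsWeight (w : ℝ → ℝ≥0) : Prop :=
  LocallyIntegrable (fun x => (w x : ℝ)) volume

/-- The measure `w(x) dx`, so that `weightMeasure w E = w(E) = ∫_E w` and
`L^p(w)` is `L^p` of this measure. -/
def weightMeasure (w : ℝ → ℝ≥0) : Measure ℝ :=
  volume.withDensity fun x => (w x : ℝ≥0∞)

/-- The one-sided maximal function
`M⁺f(x) = sup_{h>0} (1/h) ∫_x^{x+h} |f|`, with values in `[0,∞]`. -/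
def maxPlus (f : ℝ → ℝ) (x : ℝ) : ℝ≥0∞ :=
  ⨆ (h : ℝ) (_ : 0 < h), (∫⁻ y in Ioo x (x + h), ‖f y‖ₑ) / ENNReal.ofReal h

/-- Young functions `[0,∞) → [0,∞)`: continuous, convex, vanishing at `0`. -/
structure IsYoung (Φ : ℝ≥0 → ℝ≥0) : Prop where
  continuous : Continuous Φ
  convex : ConvexOn ℝ≥0 univ Φ
  map_zero : Φ 0 = 0

/-- The inverse `Φ⁻¹(t) = inf {s : Φ(s) > t}` of a Young function (the infimum of the empty set
is `∞`). For `t > 0` and `Φ` not identically zero this is the unique `s` with `Φ(s) = t`. -/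
def youngInv (Φ : ℝ≥0 → ℝ≥0) (t : ℝ≥0) : ℝ≥0∞ :=
  ⨅ (s : ℝ≥0) (_ : t < Φ s), (s : ℝ≥0∞)

/-- The Luxemburg average over the interval `(a, b)`:
`inf {r > 0 : (1/(b-a)) ∫_a^b Φ(|f|/r) ≤ 1}`, with values in `[0,∞]`. -/
def luxAvg (Φ : ℝ≥0 → ℝ≥0) (f : ℝ → ℝ) (a b : ℝ) : ℝ≥0∞ :=
  ⨅ (r : ℝ≥0) (_ : 0 < r)
    (_ : (∫⁻ x in Ioo a b, (Φ (‖f x‖₊ / r) : ℝ≥0∞)) / ENNReal.ofReal (b - a) ≤ 1), (r : ℝ≥0∞)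

/-- The one-sided Orlicz maximal function `M⁺_Φ f(x) = sup_{h>0} ‖f‖_{Φ,(x,x+h)}`. -/
def maxPlusYoung (Φ : ℝ≥0 → ℝ≥0) (f : ℝ → ℝ) (x : ℝ) : ℝ≥0∞ :=
  ⨆ (h : ℝ) (_ : 0 < h), luxAvg Φ f x (x + h)

/-- `[σ, Φ]_{W_p^-} = sup_I (1/σ(I)) ∫_I M⁺_Φ(σ^{1/p} χ_I)^p`, over bounded intervals
`I = (a,b)`. -/
def wMinusConst (p : ℝ) (σ : ℝ → ℝ≥0) (Φ : ℝ≥0 → ℝ≥0) : ℝ≥0∞ :=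
  ⨆ (a : ℝ) (b : ℝ) (_ : a < b),
    (∫⁻ x in Ioo a b,
      maxPlusYoung Φ ((Ioo a b).indicator fun y => ((σ y ^ (1 / p) : ℝ≥0) : ℝ)) x ^ p) /
      weightMeasure σ (Ioo a b)

/-- `[w, σ, Φ]_{A_p^+} = sup_{a<b<c} (w(a,b)/(c-a)) ‖σ^{1/p'} χ_{(b,c)}‖_{Φ,(a,c)}^p`. -/
def bumpConst (p : ℝ) (w σ : ℝ → ℝ≥0) (Φ : ℝ≥0 → ℝ≥0) : ℝ≥0∞ :=
  ⨆ (a : ℝ) (b : ℝ) (c : ℝ) (_ : a < b) (_ : b < c),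
    weightMeasure w (Ioo a b) / ENNReal.ofReal (c - a) *
      luxAvg Φ ((Ioo b c).indicator fun y => ((σ y ^ (1 / p.conjExponent) : ℝ≥0) : ℝ)) a c ^ p

/-- The dual weight `w^{-1/(p-1)}` (used for weights that are positive almost everywhere). -/
def dualWeight (p : ℝ) (w : ℝ → ℝ≥0) : ℝ → ℝ≥0 :=
  fun x => w x ^ (-(1 / (p - 1)))

/-- `[w]_{A_p^+} = sup_{a<b<c} (1/(c-a)) ∫_a^b w · ((1/(c-a)) ∫_b^c w^{-1/(p-1)})^{p-1}`. -/
def apPlusConst (p : ℝ) (w : ℝ → ℝ≥0) : ℝ≥0∞ :=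
  ⨆ (a : ℝ) (b : ℝ) (c : ℝ) (_ : a < b) (_ : b < c),
    weightMeasure w (Ioo a b) / ENNReal.ofReal (c - a) *
      (weightMeasure (dualWeight p w) (Ioo b c) / ENNReal.ofReal (c - a)) ^ (p - 1)

/-- `[σ]_{A_∞^-} = sup_{a<b} (1/σ(a,b)) ∫_a^b M⁺(σ χ_{(a,b)})`. -/
def aInftyMinusConst (σ : ℝ → ℝ≥0) : ℝ≥0∞ :=
  ⨆ (a : ℝ) (b : ℝ) (_ : a < b),
    (∫⁻ x in Ioo a b, maxPlus ((Ioo a b).indicator fun y => (σ y : ℝ)) x) /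
      weightMeasure σ (Ioo a b)

end

/-! Put `μ = σ dx` and `ω = w dx`. Then `M⁺(fσ)` is the maximal function `maxMeas` of the measure
`|f| dμ`, and part (i) reduces to Sawyer's local testing condition `∫_I M⁺(σχ_I)^p dω ≤ T σ(I)` for
open intervals `I`, with `T` a constant times the product of the two bump constants.

Testing implies the norm inequality in two moves. If testing holds for dyadic `I` with the left side
integrated over the whole line, a Carleson-type argument applies
(`exists_lintegral_maxMeas_withDensity_le`): `M⁺` is dominated by averages over right neighbours of
dyadic intervals, these are sorted by the size of the `μ`-average of `|f|`, and the testing bound is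
summed over disjoint maximal intervals at each level. Passing from local to global testing
(`exists_lintegral_maxMeas_restrict_le`) concerns the points `x` to the left of `(c,d)`. Where
`μ(x,d)` is about `2^m μ(c,d)`, the maximal function of `μ` on `(x,d)` exceeds that of its
restriction to `(c,d)` by a factor `2^m`, so local testing on larger intervals gains `2^{m(1-p)}`,
which is summable.

Local testing itself comes from the bumps (`weightMeasure_level_le`). Let `M = M⁺(σχ_J)`. The level
set `t < M ≤ 2t` in `J` is covered by unions `(a,b)` of two adjacent dyadic intervals of length `ℓ`,
followed by a block `(b,c)` on which the average of `σχ_J` is at least comparable to `t`. Hölder for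
Luxemburg averages applied to `σ = σ^{1/p'} σ^{1/p}`, together with the bump condition, bounds `t^p
w(a,b)` by `ℓ` times the `p`-th power of a Luxemburg average, and that average is at most the Orlicz
maximal function at every point of the second interval. Upper control of `M` at one point of the
first interval and the weak type `(1,1)` bound show that `M` is comparable to `t` on at least half
of the second interval. The sets charged at the levels `t = 2^n` therefore overlap boundedly, and
summing loses only a constant.

Part (ii) is the case of the power functions `t^{p'}` and `t^p`, applied to `f/σ`. -/

/-! ### The maximal function of a measure and its measurability -/

/-- The one-sided maximal function of a measure. -/
noncomputable def maxMeas (ν : Measure ℝ) (x : ℝ) : ℝ≥0∞ :=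
  ⨆ (h : ℝ) (_ : 0 < h), ν (Ioo x (x + h)) / ENNReal.ofReal h

theorem maxPlus_eq_maxMeas (f : ℝ → ℝ) :
    maxPlus f = maxMeas (volume.withDensity fun y => ‖f y‖ₑ) := by
  funext x
  simp only [maxPlus, maxMeas, withDensity_apply _ measurableSet_Ioo]

theorem measure_Ioo_le_maxMeas (ν : Measure ℝ) (x : ℝ) {h : ℝ} (hh : 0 < h) :
    ν (Ioo x (x + h)) ≤ maxMeas ν x * ENNReal.ofReal h := by
  rw [← ENNReal.div_le_iff (by simpa using hh) ENNReal.ofReal_ne_top]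
  exact le_iSup₂ (f := fun (h : ℝ) (_ : 0 < h) => ν (Ioo x (x + h)) / ENNReal.ofReal h) h hh

theorem maxMeas_le {ν : Measure ℝ} {x : ℝ} {t : ℝ≥0∞}
    (H : ∀ h : ℝ, 0 < h → ν (Ioo x (x + h)) ≤ t * ENNReal.ofReal h) : maxMeas ν x ≤ t := by
  refine iSup₂_le fun h hh => ?_
  rw [ENNReal.div_le_iff (by simpa using hh) ENNReal.ofReal_ne_top]
  exact H h hh

theorem maxMeas_mono {ν ν' : Measure ℝ} (h : ν ≤ ν') (x : ℝ) : maxMeas ν x ≤ maxMeas ν' x :=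
  maxMeas_le fun _ hh => (h _).trans (measure_Ioo_le_maxMeas ν' x hh)

theorem maxMeas_zero (x : ℝ) : maxMeas 0 x = 0 :=
  le_antisymm (maxMeas_le fun h _ => by simp) zero_le

/-- An open interval is the increasing union of slightly smaller ones, and each of these lies in all
sufficiently small translates of the interval. Since `maxMeas` is a supremum over uncountably many
`h`, its measurability rests on this semicontinuity. -/
theorem lowerSemicontinuous_measure_Ioo (ν : Measure ℝ) (h : ℝ) :
    LowerSemicontinuous fun x => ν (Ioo x (x + h)) := by
  intro x t ht
  have hU : Ioo x (x + h) = ⋃ n : ℕ, Ioo (x + 1 / ((n : ℝ) + 1)) (x + h - 1 / ((n : ℝ) + 1)) := by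
    ext y
    simp only [mem_Ioo, mem_iUnion]
    constructor
    · rintro ⟨h1, h2⟩
      obtain ⟨n, hn⟩ := exists_nat_one_div_lt (lt_min (sub_pos.2 h1) (sub_pos.2 h2))
      have := hn.trans_le (min_le_left _ _)
      have := hn.trans_le (min_le_right _ _)
      exact ⟨n, by linarith, by linarith⟩
    · rintro ⟨n, h1, h2⟩
      have : (0 : ℝ) < 1 / ((n : ℝ) + 1) := by positivity
      constructor <;> linarith
  have hmono : Monotone fun n : ℕ =>
      Ioo (x + 1 / ((n : ℝ) + 1)) (x + h - 1 / ((n : ℝ) + 1)) := by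
    intro m n hmn
    have : 1 / ((n : ℝ) + 1) ≤ 1 / ((m : ℝ) + 1) := by
      apply one_div_le_one_div_of_le (by positivity)
      have : (m : ℝ) ≤ n := by exact_mod_cast hmn
      linarith
    exact Ioo_subset_Ioo (by linarith) (by linarith)
  simp only at ht
  rw [hU, hmono.measure_iUnion] at ht
  obtain ⟨n, hn⟩ := lt_iSup_iff.1 ht
  have hpos : (0 : ℝ) < 1 / ((n : ℝ) + 1) := by positivity
  filter_upwards [Ioo_mem_nhds (sub_lt_self x hpos) (lt_add_of_pos_right x hpos)] with z hz
  exact hn.trans_le (measure_mono (Ioo_subset_Ioo hz.2.le (by linarith [hz.1])))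

theorem measurable_maxMeas (ν : Measure ℝ) : Measurable (maxMeas ν) := by
  apply LowerSemicontinuous.measurable
  refine lowerSemicontinuous_iSup fun h => lowerSemicontinuous_iSup fun hh => ?_
  have hc : ENNReal.ofReal h ≠ 0 := by simpa using hh
  intro x t ht
  have h1 : t * ENNReal.ofReal h < ν (Ioo x (x + h)) :=
    (ENNReal.lt_div_iff_mul_lt (.inl hc) (.inl ENNReal.ofReal_ne_top)).1 ht
  filter_upwards [lowerSemicontinuous_measure_Ioo ν h x _ h1] with z hz
  exact (ENNReal.lt_div_iff_mul_lt (.inl hc) (.inl ENNReal.ofReal_ne_top)).2 hz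

/-! ### Dyadic intervals and the blocks to their right -/

/-- The dyadic interval `[m 2^k, (m+1) 2^k)` for `i = (k, m)`. -/
def dyadic (i : ℤ × ℤ) : Set ℝ := Ico (i.2 * (2 : ℝ) ^ i.1) ((i.2 + 1) * (2 : ℝ) ^ i.1)

/-- The index of the right neighbour of a dyadic interval. -/
def rightNeighbor (i : ℤ × ℤ) : ℤ × ℤ := (i.1, i.2 + 1)

theorem measurableSet_dyadic (i : ℤ × ℤ) : MeasurableSet (dyadic i) := measurableSet_Ico

theorem mem_dyadic_iff {i : ℤ × ℤ} {x : ℝ} : x ∈ dyadic i ↔ ⌊x / (2 : ℝ) ^ i.1⌋ = i.2 := by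
  have h : (0 : ℝ) < 2 ^ i.1 := by positivity
  rw [Int.floor_eq_iff, le_div_iff₀ h, div_lt_iff₀ h, dyadic, mem_Ico]

theorem volume_dyadic (i : ℤ × ℤ) : volume (dyadic i) = ENNReal.ofReal (2 ^ i.1) := by
  rw [dyadic, Real.volume_Ico]; congr 1; ring

theorem floor_div_two_zpow_succ (x : ℝ) (k : ℤ) :
    ⌊x / (2 : ℝ) ^ (k + 1)⌋ = ⌊x / (2 : ℝ) ^ k⌋ / 2 := by
  rw [zpow_add_one₀ (by norm_num), ← div_div]
  exact_mod_cast Int.floor_div_natCast (x / (2 : ℝ) ^ k) 2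

theorem floor_div_two_zpow_congr {x y : ℝ} {k l : ℤ} (hkl : k ≤ l)
    (h : ⌊x / (2 : ℝ) ^ k⌋ = ⌊y / (2 : ℝ) ^ k⌋) : ⌊x / (2 : ℝ) ^ l⌋ = ⌊y / (2 : ℝ) ^ l⌋ := by
  induction l, hkl using Int.leInduction with
  | base => exact h
  | succ l _ ih => rw [floor_div_two_zpow_succ, floor_div_two_zpow_succ, ih]

theorem dyadic_subset_of_le {i j : ℤ × ℤ} (hij : i.1 ≤ j.1) (h : (dyadic i ∩ dyadic j).Nonempty) :
    dyadic i ⊆ dyadic j := by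
  obtain ⟨x, hi, hj⟩ := h
  intro y hy
  rw [mem_dyadic_iff] at *
  rw [← hj]
  exact floor_div_two_zpow_congr hij (hy.trans hi.symm)

theorem le_of_dyadic_subset {i j : ℤ × ℤ} (h : dyadic i ⊆ dyadic j) : i.1 ≤ j.1 := by
  have := measure_mono (μ := volume) h
  rw [volume_dyadic, volume_dyadic, ENNReal.ofReal_le_ofReal_iff (by positivity)] at this
  exact (zpow_le_zpow_iff_right₀ (by norm_num)).1 this

/-- A family of dyadic intervals of bounded size has a disjoint subfamily of maximal elements. -/
theorem exists_maximal_dyadic (F : Set (ℤ × ℤ)) (K : ℤ) (hK : ∀ i ∈ F, i.1 ≤ K) :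
    ∃ G ⊆ F, G.PairwiseDisjoint dyadic ∧ ∀ i ∈ F, ∃ j ∈ G, dyadic i ⊆ dyadic j := by
  refine ⟨{i ∈ F | ∀ j ∈ F, dyadic i ⊆ dyadic j → j.1 ≤ i.1}, fun i hi => hi.1, ?_, ?_⟩
  · intro i hi j hj hne
    simp only [Function.onFun]
    by_contra hd
    rw [Set.not_disjoint_iff_nonempty_inter] at hd
    apply hne
    have hk : i.1 = j.1 := by
      rcases le_total i.1 j.1 with h | h
      · exact le_antisymm h (hi.2 j hj.1 (dyadic_subset_of_le h hd))
      · exact le_antisymm (hj.2 i hi.1 (dyadic_subset_of_le h (inter_comm _ _ ▸ hd))) h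
    obtain ⟨x, hx, hx'⟩ := hd
    rw [mem_dyadic_iff] at hx hx'
    refine Prod.ext hk ?_
    rw [← hx, ← hx', hk]
  · intro i hi
    obtain ⟨k, ⟨j, hj, hij, rfl⟩, hmax⟩ := Int.exists_greatest_of_bdd
      (P := fun k => ∃ j ∈ F, dyadic i ⊆ dyadic j ∧ j.1 = k)
      ⟨K, by rintro k ⟨j, hj, -, rfl⟩; exact hK j hj⟩ ⟨i.1, i, hi, Subset.rfl, rfl⟩
    exact ⟨j, ⟨hj, fun j' hj' h => hmax _ ⟨j', hj', hij.trans h, rfl⟩⟩, hij⟩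

/-- The block `[(m+s) 2^k, (m+2s) 2^k)` to the right of the dyadic interval `(k, m)`. -/
def rightBlock (s : ℕ) (i : ℤ × ℤ) : Set ℝ :=
  Ico ((i.2 + s) * (2 : ℝ) ^ i.1) ((i.2 + 2 * s) * (2 : ℝ) ^ i.1)

theorem rightBlock_one (i : ℤ × ℤ) : rightBlock 1 i = dyadic (rightNeighbor i) := by
  simp only [rightBlock, dyadic, rightNeighbor]
  push_cast
  congr 1
  ring

theorem mem_rightBlock_of_floor {s : ℕ} {x y : ℝ} {k : ℤ}
    (h1 : (s : ℤ) ≤ ⌊y / (2 : ℝ) ^ k⌋ - ⌊x / (2 : ℝ) ^ k⌋)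
    (h2 : ⌊y / (2 : ℝ) ^ k⌋ - ⌊x / (2 : ℝ) ^ k⌋ < 2 * s) :
    y ∈ rightBlock s (k, ⌊x / (2 : ℝ) ^ k⌋) := by
  have h : (0 : ℝ) < 2 ^ k := by positivity
  have a1 : ⌊x / (2 : ℝ) ^ k⌋ + (s : ℤ) ≤ ⌊y / (2 : ℝ) ^ k⌋ := by linarith
  have a2 : ⌊y / (2 : ℝ) ^ k⌋ < ⌊x / (2 : ℝ) ^ k⌋ + 2 * (s : ℤ) := by linarith
  rw [Int.le_floor, le_div_iff₀ h] at a1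
  rw [Int.floor_lt, div_lt_iff₀ h] at a2
  push_cast at a1 a2
  exact ⟨a1, a2⟩

/-- Let `d j` be the number of dyadic steps of length `2^j` from `x` to `y`. Choose the largest `j ≤
k` with `d j ≥ s`. One scale up, `d (j+1) ≤ s - 1`, and halving floors gives `d j ≤ 2 d (j+1) + 1 <
2s`; at the top scale `d k ≤ 1` instead. So the blocks attached to `x` cover everything just to the
right of `x`. -/
theorem exists_mem_rightBlock {s : ℕ} (hs : 1 ≤ s) {x y : ℝ} {k : ℤ} (hxy : x < y)
    (hk : y < x + 2 ^ k) : ∃ j ≤ k, y ∈ rightBlock s (j, ⌊x / (2 : ℝ) ^ j⌋) := by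
  have hpos : ∀ k : ℤ, (0 : ℝ) < 2 ^ k := fun k => by positivity
  set d : ℤ → ℤ := fun j => ⌊y / (2 : ℝ) ^ j⌋ - ⌊x / (2 : ℝ) ^ j⌋ with hd
  have hdk : d k ≤ 1 := by
    have : y / 2 ^ k < x / 2 ^ k + 1 := by
      rw [div_lt_iff₀ (hpos k), add_mul, div_mul_cancel₀ _ (hpos k).ne']; linarith
    have h2 : ⌊y / (2 : ℝ) ^ k⌋ ≤ ⌊x / (2 : ℝ) ^ k + 1⌋ := Int.floor_mono this.le
    rw [Int.floor_add_one] at h2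
    simp only [hd]; linarith
  have hex : ∃ j ≤ k, (s : ℤ) ≤ d j := by
    obtain ⟨n, hn⟩ := exists_pow_lt_of_lt_one
      (div_pos (sub_pos.2 hxy) (by positivity : (0 : ℝ) < s + 1)) (by norm_num : (1 / 2 : ℝ) < 1)
    refine ⟨min k (-(n : ℤ)), min_le_left _ _, ?_⟩
    set j := min k (-(n : ℤ))
    have hj : (2 : ℝ) ^ j ≤ (1 / 2) ^ n := by
      calc (2 : ℝ) ^ j ≤ 2 ^ (-(n : ℤ)) := zpow_le_zpow_right₀ (by norm_num) (min_le_right _ _)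
        _ = (1 / 2) ^ n := by rw [zpow_neg, zpow_natCast, one_div, inv_pow]
    have h3 : (2 : ℝ) ^ j * (s + 1) < y - x := by
      have := hj.trans_lt hn
      rwa [lt_div_iff₀ (by positivity)] at this
    have h4 : x / 2 ^ j + s ≤ y / 2 ^ j := by
      rw [le_div_iff₀ (hpos j), add_mul, div_mul_cancel₀ _ (hpos j).ne']
      nlinarith [hpos j]
    have h5 : ⌊x / (2 : ℝ) ^ j + (s : ℕ)⌋ ≤ ⌊y / (2 : ℝ) ^ j⌋ := Int.floor_mono h4
    rw [Int.floor_add_natCast] at h5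
    simp only [hd]; linarith
  obtain ⟨j, ⟨hjk, hjs⟩, hmax⟩ := Int.exists_greatest_of_bdd
    (P := fun j => j ≤ k ∧ (s : ℤ) ≤ d j) ⟨k, fun j hj => hj.1⟩ hex
  refine ⟨j, hjk, mem_rightBlock_of_floor hjs ?_⟩
  change d j < 2 * s
  rcases hjk.eq_or_lt with rfl | hlt
  · have : (1 : ℤ) ≤ s := by exact_mod_cast hs
    linarith
  · have h6 : d (j + 1) < s := by
      by_contra hcon
      have := hmax (j + 1) ⟨hlt, not_lt.1 hcon⟩
      linarith
    simp only [hd, floor_div_two_zpow_succ] at h6 ⊢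
    omega

theorem tsum_two_zpow_le (k : ℤ) :
    ∑' n : ℕ, ENNReal.ofReal ((2 : ℝ) ^ (k - n)) = ENNReal.ofReal (2 ^ (k + 1)) := by
  have h : ∀ n : ℕ, (2 : ℝ) ^ (k - n) = 2 ^ k * (1 / 2) ^ n := fun n => by
    rw [zpow_sub₀ (by norm_num), zpow_natCast, one_div, inv_pow, div_eq_mul_inv]
  have hs : HasSum (fun n : ℕ => (2 : ℝ) ^ (k - n)) (2 ^ (k + 1)) := by
    simp_rw [h]
    rw [zpow_add_one₀ (by norm_num)]
    exact hasSum_geometric_two.mul_left _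
  rw [← ENNReal.ofReal_tsum_of_nonneg (fun n => by positivity) hs.summable, hs.tsum_eq]

/-- Domination of the one-sided maximal function by averages over blocks to the right of
dyadic intervals. -/
theorem maxMeas_le_iSup_rightBlock (ν : Measure ℝ) {s : ℕ} (hs : 1 ≤ s) (x : ℝ) :
    maxMeas ν x ≤ 4 * ⨆ (i : ℤ × ℤ) (_ : x ∈ dyadic i),
      ν (rightBlock s i) / ENNReal.ofReal (2 ^ i.1) := by
  set R := ⨆ (i : ℤ × ℤ) (_ : x ∈ dyadic i), ν (rightBlock s i) / ENNReal.ofReal (2 ^ i.1) with hR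
  have hblock : ∀ j : ℤ, ν (rightBlock s (j, ⌊x / (2 : ℝ) ^ j⌋)) ≤ R * ENNReal.ofReal (2 ^ j) := by
    intro j
    rw [← ENNReal.div_le_iff (by simp; positivity) ENNReal.ofReal_ne_top]
    exact le_iSup₂ (f := fun (i : ℤ × ℤ) (_ : x ∈ dyadic i) =>
      ν (rightBlock s i) / ENNReal.ofReal (2 ^ i.1)) (j, ⌊x / (2 : ℝ) ^ j⌋) (mem_dyadic_iff.2 rfl)
  refine maxMeas_le fun h hh => ?_
  obtain ⟨k, hk1, hk2⟩ := exists_mem_Ioc_zpow hh (by norm_num : (1 : ℝ) < 2)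
  -- Here `2^k < h ≤ 2^(k+1)`. Blocks of scale at most `k + 1` cover the window, and their scales
  -- sum to `2^(k+2) ≤ 4h`, whence the constant 4.
  have hsub : Ioo x (x + h) ⊆
      ⋃ n : ℕ, rightBlock s (k + 1 - n, ⌊x / (2 : ℝ) ^ (k + 1 - n : ℤ)⌋) := by
    intro y hy
    obtain ⟨j, hj, hyj⟩ := exists_mem_rightBlock hs hy.1 (hy.2.trans_le (by linarith :
      x + h ≤ x + 2 ^ (k + 1)))
    refine mem_iUnion.2 ⟨(k + 1 - j).toNat, ?_⟩
    have : k + 1 - ((k + 1 - j).toNat : ℤ) = j := by omega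
    rwa [this]
  calc ν (Ioo x (x + h)) ≤ ∑' n : ℕ, ν (rightBlock s (k + 1 - n, ⌊x / (2 : ℝ) ^ (k + 1 - n : ℤ)⌋)) :=
        (measure_mono hsub).trans (measure_iUnion_le _)
    _ ≤ ∑' n : ℕ, R * ENNReal.ofReal (2 ^ (k + 1 - n : ℤ)) :=
        ENNReal.tsum_le_tsum fun n => hblock _
    _ = R * ENNReal.ofReal (2 ^ (k + 1 + 1)) := by rw [ENNReal.tsum_mul_left, tsum_two_zpow_le]
    _ ≤ R * ENNReal.ofReal (4 * h) := by
        gcongr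
        rw [zpow_add_one₀ (by norm_num), zpow_add_one₀ (by norm_num)]
        linarith
    _ = 4 * R * ENNReal.ofReal h := by
        rw [ENNReal.ofReal_mul (by norm_num)]
        norm_num
        ring

theorem dyadic_subset_Ioo {i : ℤ × ℤ} {x : ℝ} (hx : x ∈ dyadic i) :
    dyadic (rightNeighbor i) ⊆ Ioo x (x + 2 * 2 ^ i.1) := by
  intro y hy
  simp only [dyadic, rightNeighbor, mem_Ico, Int.cast_add, Int.cast_one] at hx hy
  constructor <;> linarith

/-- If `I⁺ ⊆ J⁺` for dyadic intervals `I`, `J`, then `I ⊆ J ∪ J⁺`. -/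
theorem dyadic_subset_union {i j : ℤ × ℤ}
    (h : dyadic (rightNeighbor i) ⊆ dyadic (rightNeighbor j)) :
    dyadic i ⊆ Ico (j.2 * (2 : ℝ) ^ j.1) ((j.2 + 2) * 2 ^ j.1) := by
  have hk : (2 : ℝ) ^ i.1 ≤ 2 ^ j.1 :=
    zpow_le_zpow_right₀ (by norm_num)
      (le_of_dyadic_subset (i := rightNeighbor i) (j := rightNeighbor j) h)
  have hi : (0 : ℝ) < 2 ^ i.1 := by positivity
  simp only [dyadic, rightNeighbor, Int.cast_add, Int.cast_one] at h ⊢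
  rw [Ico_subset_Ico_iff (by linarith)] at h
  exact Ico_subset_Ico (by linarith [h.1]) (by linarith [h.2])

/-! ### The weak type (1,1) inequality -/

theorem exists_forall_zpow_bound {t c : ℝ≥0∞} (ht0 : t ≠ 0) (htop : t ≠ ∞) (hc : c ≠ ∞) :
    ∃ K : ℤ, ∀ k : ℤ, t * ENNReal.ofReal (2 ^ k) ≤ c → k ≤ K := by
  have hfin : c / t ≠ ∞ := ENNReal.div_ne_top hc ht0
  obtain ⟨n, hn⟩ := pow_unbounded_of_one_lt (c / t).toReal (by norm_num : (1 : ℝ) < 2)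
  refine ⟨n, fun k hk => ?_⟩
  have h1 : ENNReal.ofReal (2 ^ k) ≤ c / t := by
    rwa [ENNReal.le_div_iff_mul_le (.inl ht0) (.inl htop), mul_comm]
  have h2 := (ENNReal.ofReal_le_iff_le_toReal hfin).1 h1
  have h3 : (2 : ℝ) ^ k ≤ 2 ^ (n : ℤ) := by rw [zpow_natCast]; linarith
  exact (zpow_le_zpow_iff_right₀ (by norm_num)).1 h3

/-- The weak type `(1,1)` inequality for the one-sided maximal function of a finite measure. -/
theorem volume_maxMeas_gt_le (ν : Measure ℝ) [IsFiniteMeasure ν] {t : ℝ≥0∞} (ht0 : t ≠ 0)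
    (htop : t ≠ ∞) : t * volume {x | t < maxMeas ν x} ≤ 8 * ν univ := by
  set F : Set (ℤ × ℤ) := {j | t * ENNReal.ofReal (2 ^ j.1) ≤ 4 * ν (dyadic j)} with hF
  obtain ⟨K, hK⟩ := exists_forall_zpow_bound ht0 htop
    (ENNReal.mul_ne_top (by simp) (measure_ne_top ν univ) : 4 * ν univ ≠ ∞)
  replace hK : ∀ i ∈ F, i.1 ≤ K := fun i hi => hK _ (le_trans hi (by gcongr; exact subset_univ _))
  obtain ⟨G, hGF, hGd, hG⟩ := exists_maximal_dyadic F K hK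
  -- The selected intervals are heavy right neighbours. A point of the level set lies one interval
  -- to the left of a heavy interval, hence in the selected interval or its left neighbour. The
  -- doubled length and the factor 4 of the domination give 8.
  set U : ℤ × ℤ → Set ℝ := fun j => Ico ((j.2 - 1) * (2 : ℝ) ^ j.1) ((j.2 + 1) * 2 ^ j.1)
  have hcov : {x | t < maxMeas ν x} ⊆ ⋃ j : G, U j := by
    intro x hx
    have hx' := lt_of_lt_of_le hx (maxMeas_le_iSup_rightBlock ν le_rfl x)
    rw [mul_comm, ← ENNReal.div_lt_iff (.inl (by norm_num)) (.inl (by norm_num))] at hx'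
    obtain ⟨i, hi⟩ := lt_iSup_iff.1 hx'
    obtain ⟨hxi, hi⟩ := lt_iSup_iff.1 hi
    rw [rightBlock_one] at hi
    have hiF : rightNeighbor i ∈ F := by
      have hne : ENNReal.ofReal ((2 : ℝ) ^ i.1) ≠ 0 := by simp; positivity
      rw [ENNReal.lt_div_iff_mul_lt (.inl hne) (.inl ENNReal.ofReal_ne_top)] at hi
      change (_ : ℝ≥0∞) ≤ _
      calc t * ENNReal.ofReal (2 ^ (rightNeighbor i).1)
          = 4 * (t / 4 * ENNReal.ofReal (2 ^ i.1)) := by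
            rw [← mul_assoc, ENNReal.mul_div_cancel (by norm_num) (by norm_num)]; rfl
        _ ≤ _ := by gcongr
    obtain ⟨j, hj, hij⟩ := hG _ hiF
    refine mem_iUnion.2 ⟨⟨j, hj⟩, ?_⟩
    have hjj : j = rightNeighbor (j.1, j.2 - 1) := by simp [rightNeighbor]
    rw [hjj] at hij
    have := dyadic_subset_union hij hxi
    simp only [U]
    push_cast at this
    convert this using 2
    ring
  have hvol : ∀ j ∈ F, t * volume (U j) ≤ 8 * ν (dyadic j) := by
    intro j hj
    have : volume (U j) = 2 * ENNReal.ofReal (2 ^ j.1) := by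
      rw [Real.volume_Ico, show (2 : ℝ≥0∞) = ENNReal.ofReal 2 by simp,
        ← ENNReal.ofReal_mul (by norm_num)]
      congr 1; ring
    rw [this]
    calc t * (2 * ENNReal.ofReal (2 ^ j.1)) = 2 * (t * ENNReal.ofReal (2 ^ j.1)) := by ring
      _ ≤ 2 * (4 * ν (dyadic j)) := mul_le_mul_right hj 2
      _ = 8 * ν (dyadic j) := by ring
  calc t * volume {x | t < maxMeas ν x} ≤ t * ∑' j : G, volume (U j) := by
        gcongr; exact (measure_mono hcov).trans (measure_iUnion_le _)
    _ = ∑' j : G, t * volume (U j) := ENNReal.tsum_mul_left.symm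
    _ ≤ ∑' j : G, 8 * ν (dyadic j) := ENNReal.tsum_le_tsum fun j => hvol j (hGF j.2)
    _ = 8 * ∑' j : G, ν (dyadic j) := ENNReal.tsum_mul_left
    _ ≤ 8 * ν univ := by
        gcongr
        exact tsum_measure_le_measure_univ
          (fun j => (measurableSet_dyadic _).nullMeasurableSet)
          (fun i j hij => (hGd i.2 j.2 (fun h => hij (Subtype.ext h))).aedisjoint)

/-! ### Carleson embedding: global dyadic testing suffices -/

theorem ENNReal.exists_tsum_two_zpow_rpow_le {q : ℝ} (hq : 0 < q) :
    ∃ C : ℝ≥0∞, C ≠ ∞ ∧ ∀ y : ℝ≥0∞,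
      ∑' n : ℤ, (if (2 : ℝ≥0∞) ^ n < y then ((2 : ℝ≥0∞) ^ n) ^ q else 0) ≤ C * y ^ q := by
  have hr : (2 : ℝ≥0∞) ^ (-q) < 1 := ENNReal.rpow_lt_one_of_one_lt_of_neg (by norm_num) (by linarith)
  refine ⟨(1 - (2 : ℝ≥0∞) ^ (-q))⁻¹, ?_, fun y => ?_⟩
  · exact ENNReal.inv_ne_top.2 (tsub_pos_iff_lt.2 hr).ne'
  rcases eq_or_ne y 0 with rfl | hy0
  · simp
  rcases eq_or_ne y ∞ with rfl | hy
  · rw [ENNReal.top_rpow_of_pos hq, ENNReal.mul_top]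
    · exact le_top
    · simp
  obtain ⟨N, hN1, hN2⟩ := ENNReal.exists_mem_Ioc_zpow hy0 hy (by norm_num : (1 : ℝ≥0∞) < 2) (by norm_num)
  have hinj : Function.Injective fun j : ℕ => N - (j : ℤ) := fun a b h => by
    simpa using h
  rw [← hinj.tsum_eq]
  · calc ∑' j : ℕ, (if (2 : ℝ≥0∞) ^ (N - (j : ℤ)) < y then ((2 : ℝ≥0∞) ^ (N - (j : ℤ))) ^ q else 0)
        ≤ ∑' j : ℕ, ((2 : ℝ≥0∞) ^ N) ^ q * ((2 : ℝ≥0∞) ^ (-q)) ^ j := by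
          refine ENNReal.tsum_le_tsum fun j => ?_
          have : ((2 : ℝ≥0∞) ^ (N - (j : ℤ))) ^ q = ((2 : ℝ≥0∞) ^ N) ^ q * ((2 : ℝ≥0∞) ^ (-q)) ^ j := by
            rw [← ENNReal.rpow_intCast, ← ENNReal.rpow_intCast, ← ENNReal.rpow_natCast,
              ← ENNReal.rpow_mul, ← ENNReal.rpow_mul, ← ENNReal.rpow_mul,
              ← ENNReal.rpow_add _ _ (by norm_num) (by norm_num)]
            congr 1
            push_cast
            ring
          rw [← this]
          split_ifs
          · exact le_rfl
          · exact zero_le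
      _ = (1 - (2 : ℝ≥0∞) ^ (-q))⁻¹ * ((2 : ℝ≥0∞) ^ N) ^ q := by
          rw [ENNReal.tsum_mul_left, ENNReal.tsum_geometric, mul_comm]
      _ ≤ _ := by gcongr
  · intro n hn
    simp only [Function.mem_support, ne_eq, ite_eq_right_iff, not_forall] at hn
    have h1 : n < N + 1 := by
      by_contra hcon
      have := ENNReal.zpow_le_of_le (by norm_num : (1 : ℝ≥0∞) ≤ 2) (not_lt.1 hcon)
      exact absurd hn.1 (not_lt.2 (hN2.trans this))
    exact ⟨(N - n).toNat, by simp only; omega⟩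

/-- A single term suffices for finite `y`. The threshold `2^(n+1)` leaves a factor 2 of room for
truncating the density at height `2^n`. -/
theorem ENNReal.rpow_le_tsum_two_zpow {p : ℝ} (hp : 0 < p) (y : ℝ≥0∞) :
    y ^ p ≤ ∑' n : ℤ, (if (2 : ℝ≥0∞) ^ (n + 1) < y then ((2 : ℝ≥0∞) ^ (n + 2)) ^ p else 0) := by
  rcases eq_or_ne y 0 with rfl | hy0
  · simp [hp]
  rcases eq_or_ne y ∞ with rfl | hy
  · rw [ENNReal.top_rpow_of_pos hp]
    calc ∞ = ∑' _ : ℕ, (1 : ℝ≥0∞) := by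
          rw [ENNReal.tsum_const_eq_top_of_ne_zero one_ne_zero]
      _ ≤ ∑' n : ℕ, (if (2 : ℝ≥0∞) ^ ((n : ℤ) + 1) < ∞ then ((2 : ℝ≥0∞) ^ ((n : ℤ) + 2)) ^ p else 0) := by
          refine ENNReal.tsum_le_tsum fun n => ?_
          rw [if_pos (ENNReal.zpow_lt_top (by norm_num) (by norm_num) _)]
          refine ENNReal.one_le_rpow ?_ hp
          rw [show (n : ℤ) + 2 = ((n + 2 : ℕ) : ℤ) by push_cast; rfl, zpow_natCast]
          exact one_le_pow₀ (by norm_num)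
      _ ≤ _ := ENNReal.tsum_comp_le_tsum_of_injective Nat.cast_injective
          fun n : ℤ => (if (2 : ℝ≥0∞) ^ (n + 1) < ∞ then ((2 : ℝ≥0∞) ^ (n + 2)) ^ p else 0)
  obtain ⟨N, hN1, hN2⟩ := ENNReal.exists_mem_Ioc_zpow hy0 hy (by norm_num : (1 : ℝ≥0∞) < 2) (by norm_num)
  refine le_trans ?_ (ENNReal.le_tsum (N - 1))
  rw [if_pos (by simpa using hN1)]
  rw [show N - 1 + 2 = N + 1 by ring]
  gcongr

theorem dyadic_measure_ne_top (μ : Measure ℝ) [IsLocallyFiniteMeasure μ] (i : ℤ × ℤ) :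
    μ (dyadic i) ≠ ∞ :=
  ((measure_mono Ico_subset_Icc_self).trans_lt isCompact_Icc.measure_lt_top).ne

/-- The Carleson packing step in the level-set form. -/
theorem lintegral_iSup_level_le {p : ℝ} (hp : 1 < p) {μ ω : Measure ℝ} [IsLocallyFiniteMeasure μ]
    {T : ℝ≥0∞}
    (hT : ∀ i, ∫⁻ x, maxMeas (μ.restrict (dyadic i)) x ^ p ∂ω ≤ T * μ (dyadic i))
    {F : ℝ → ℝ≥0∞} (hF : Measurable F) (K n : ℤ) :
    ∫⁻ x, (⨆ i : {i : ℤ × ℤ // i.1 ≤ K ∧ (2 : ℝ≥0∞) ^ (n + 1) * μ (dyadic (rightNeighbor i)) <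
        μ.withDensity F (dyadic (rightNeighbor i))},
      (dyadic i).indicator (fun _ => (μ (dyadic (rightNeighbor i)) /
        ENNReal.ofReal (2 ^ i.1.1)) ^ p) x) ∂ω ≤
      2 ^ p * T * ((2 : ℝ≥0∞) ^ (-n) * ∫⁻ x in {x | (2 : ℝ≥0∞) ^ n < F x}, F x ∂μ) := by
  have h2n : (2 : ℝ≥0∞) ^ n ≠ ∞ := (ENNReal.zpow_lt_top (by norm_num) (by norm_num) _).ne
  have h2n0 : (2 : ℝ≥0∞) ^ n ≠ 0 := (ENNReal.zpow_pos (by norm_num) (by norm_num) _).ne'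
  set E : Set ℝ := {x | (2 : ℝ≥0∞) ^ n < F x} with hE
  have hEm : MeasurableSet E := measurableSet_lt measurable_const hF
  set Fam : Set (ℤ × ℤ) := {j | j.1 ≤ K ∧
    (2 : ℝ≥0∞) ^ (n + 1) * μ (dyadic j) < μ.withDensity F (dyadic j)} with hFam
  obtain ⟨G, hGF, hGd, hG⟩ := exists_maximal_dyadic Fam K fun i hi => hi.1
  -- The average of `F` over `dyadic j` exceeds `2^(n+1)`, while the part where `F ≤ 2^n`
  -- contributes at most `2^n μ(dyadic j)`. The rest comes from `E`.
  have hmass : ∀ j ∈ Fam, (2 : ℝ≥0∞) ^ n * μ (dyadic j) ≤ ∫⁻ x in dyadic j ∩ E, F x ∂μ := by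
    intro j hj
    have hfin : (2 : ℝ≥0∞) ^ n * μ (dyadic j) ≠ ∞ :=
      ENNReal.mul_ne_top h2n (dyadic_measure_ne_top μ j)
    have h1 : (2 : ℝ≥0∞) ^ n * μ (dyadic j) + (2 : ℝ≥0∞) ^ n * μ (dyadic j) ≤
        (∫⁻ x in dyadic j ∩ E, F x ∂μ) + (2 : ℝ≥0∞) ^ n * μ (dyadic j) := by
      calc (2 : ℝ≥0∞) ^ n * μ (dyadic j) + (2 : ℝ≥0∞) ^ n * μ (dyadic j)
          = (2 : ℝ≥0∞) ^ (n + 1) * μ (dyadic j) := by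
            rw [ENNReal.zpow_add (by norm_num) (by norm_num), zpow_one]; ring
        _ ≤ ∫⁻ x in dyadic j, F x ∂μ := by
            rw [← withDensity_apply _ (measurableSet_dyadic j)]; exact hj.2.le
        _ = (∫⁻ x in dyadic j ∩ E, F x ∂μ) + ∫⁻ x in dyadic j \ E, F x ∂μ :=
            (lintegral_inter_add_sdiff _ _ hEm).symm
        _ ≤ _ := by
            gcongr
            calc ∫⁻ x in dyadic j \ E, F x ∂μ ≤ ∫⁻ _ in dyadic j \ E, (2 : ℝ≥0∞) ^ n ∂μ :=
                  setLIntegral_mono measurable_const fun x hx => not_lt.1 hx.2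
              _ = (2 : ℝ≥0∞) ^ n * μ (dyadic j \ E) := setLIntegral_const _ _
              _ ≤ _ := by gcongr; exact sdiff_subset
    exact (ENNReal.add_le_add_iff_right hfin).1 h1
  -- For `x` in `dyadic i`, the right neighbour lies in the window of length `2·2^i.1` starting at
  -- `x` and inside some maximal interval `j`. Its average is thus at most twice the maximal
  -- function of `μ` restricted to `j`.
  calc _ ≤ ∫⁻ x, ∑' j : G, (2 * maxMeas (μ.restrict (dyadic j)) x) ^ p ∂ω := by
        refine lintegral_mono fun x => iSup_le fun i => ?_
        by_cases hx : x ∈ dyadic i.1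
        · rw [indicator_of_mem hx]
          obtain ⟨j, hj, hij⟩ := hG (rightNeighbor i) ⟨i.2.1, i.2.2⟩
          refine le_trans ?_ (ENNReal.le_tsum ⟨j, hj⟩)
          gcongr
          have hpos : (0 : ℝ) < 2 ^ i.1.1 := by positivity
          rw [ENNReal.div_le_iff (by simpa using hpos) ENNReal.ofReal_ne_top]
          calc μ (dyadic (rightNeighbor i))
              ≤ μ.restrict (dyadic j) (Ioo x (x + 2 * 2 ^ i.1.1)) := by
                rw [Measure.restrict_apply measurableSet_Ioo]
                exact measure_mono (subset_inter (dyadic_subset_Ioo hx) hij)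
            _ ≤ maxMeas (μ.restrict (dyadic j)) x * ENNReal.ofReal (2 * 2 ^ i.1.1) :=
                measure_Ioo_le_maxMeas _ _ (by positivity)
            _ = _ := by
                rw [ENNReal.ofReal_mul (by norm_num)]
                norm_num
                ring
        · rw [indicator_of_notMem hx]; exact zero_le
    _ = ∑' j : G, ∫⁻ x, (2 * maxMeas (μ.restrict (dyadic j)) x) ^ p ∂ω :=
        lintegral_tsum fun j => (((measurable_maxMeas _).const_mul _).pow_const _).aemeasurable
    _ ≤ ∑' j : G, 2 ^ p * T * ((2 : ℝ≥0∞) ^ (-n) * ∫⁻ x in dyadic j ∩ E, F x ∂μ) := by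
        refine ENNReal.tsum_le_tsum fun j => ?_
        simp_rw [ENNReal.mul_rpow_of_nonneg _ _ (by linarith : (0 : ℝ) ≤ p)]
        rw [lintegral_const_mul _ ((measurable_maxMeas _).pow_const _), mul_assoc]
        gcongr
        refine (hT j).trans ?_
        gcongr
        calc μ (dyadic j) = (2 : ℝ≥0∞) ^ (-n) * ((2 : ℝ≥0∞) ^ n * μ (dyadic j)) := by
              rw [← mul_assoc, ENNReal.zpow_neg, ENNReal.inv_mul_cancel h2n0 h2n, one_mul]
          _ ≤ _ := by gcongr; exact hmass j (hGF j.2)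
    _ = 2 ^ p * T * ((2 : ℝ≥0∞) ^ (-n) * ∑' j : G, ∫⁻ x in dyadic j ∩ E, F x ∂μ) := by
        rw [ENNReal.tsum_mul_left, ENNReal.tsum_mul_left]
    _ ≤ _ := by
        gcongr
        rw [← lintegral_iUnion (fun j => (measurableSet_dyadic _).inter hEm)]
        · exact lintegral_mono_set (iUnion_subset fun j => inter_subset_right)
        · intro i j hij
          exact (hGd i.2 j.2 (fun h => hij (Subtype.ext h))).mono inter_subset_left inter_subset_left

/-- Two-weight inequality for the one-sided maximal function from global testing on dyadic
intervals. -/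
theorem exists_lintegral_maxMeas_withDensity_le {p : ℝ} (hp : 1 < p) :
    ∃ C : ℝ≥0∞, C ≠ ∞ ∧ ∀ (μ ω : Measure ℝ) [IsLocallyFiniteMeasure μ] (T : ℝ≥0∞),
      (∀ i, ∫⁻ x, maxMeas (μ.restrict (dyadic i)) x ^ p ∂ω ≤ T * μ (dyadic i)) →
      ∀ F : ℝ → ℝ≥0∞, Measurable F →
        ∫⁻ x, maxMeas (μ.withDensity F) x ^ p ∂ω ≤ C * T * ∫⁻ x, F x ^ p ∂μ := by
  have hp0 : 0 < p := by linarith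
  obtain ⟨C, hC, hsum⟩ := ENNReal.exists_tsum_two_zpow_rpow_le (sub_pos.2 hp)
  refine ⟨4 ^ p * (4 ^ p * 2 ^ p) * C, ?_, fun μ ω _ T hT F hF => ?_⟩
  · refine ENNReal.mul_ne_top (ENNReal.mul_ne_top ?_ (ENNReal.mul_ne_top ?_ ?_)) hC <;>
    exact ENNReal.rpow_ne_top_of_nonneg hp0.le (by norm_num)
  set ν := μ.withDensity F with hν
  -- Truncating at scale `K` guarantees that maximal intervals exist; monotone convergence removes
  -- the truncation.
  set N : ℕ → ℝ → ℝ≥0∞ := fun K x => ⨆ i : {i : ℤ × ℤ // i.1 ≤ (K : ℤ)},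
    (dyadic i).indicator (fun _ => (ν (dyadic (rightNeighbor i)) /
      ENNReal.ofReal (2 ^ i.1.1)) ^ p) x with hN
  have hNm : ∀ K, Measurable (N K) := fun K => Measurable.iSup fun i =>
    measurable_const.indicator (measurableSet_dyadic _)
  have hmono : Monotone N := by
    intro K L hKL x
    refine iSup_le fun i => ?_
    have hKL' : (K : ℤ) ≤ L := by exact_mod_cast hKL
    exact le_iSup (fun i : {i : ℤ × ℤ // i.1 ≤ (L : ℤ)} =>
      (dyadic i).indicator (fun _ => (ν (dyadic (rightNeighbor i)) /
        ENNReal.ofReal (2 ^ i.1.1)) ^ p) x) ⟨i.1, i.2.trans hKL'⟩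
  have hle : ∀ x, maxMeas ν x ^ p ≤ 4 ^ p * ⨆ K, N K x := by
    intro x
    refine (ENNReal.rpow_le_rpow (maxMeas_le_iSup_rightBlock ν le_rfl x) hp0.le).trans ?_
    rw [ENNReal.mul_rpow_of_nonneg _ _ hp0.le]
    gcongr
    rw [← ENNReal.le_rpow_inv_iff hp0]
    refine iSup₂_le fun i hi => ?_
    rw [ENNReal.le_rpow_inv_iff hp0, rightBlock_one]
    refine le_trans ?_ (le_iSup _ i.1.toNat)
    refine le_trans ?_ (le_iSup _ ⟨i, by omega⟩)
    rw [indicator_of_mem hi]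
  have hlevel : ∀ K : ℕ, ∫⁻ x, N K x ∂ω ≤
      (4 ^ p * 2 ^ p) * C * T * ∫⁻ x, F x ^ p ∂μ := by
    intro K
    set H : ℤ → ℝ → ℝ≥0∞ := fun n x =>
      ⨆ i : {i : ℤ × ℤ // i.1 ≤ (K : ℤ) ∧ (2 : ℝ≥0∞) ^ (n + 1) * μ (dyadic (rightNeighbor i)) <
        ν (dyadic (rightNeighbor i))},
      (dyadic i).indicator (fun _ => (μ (dyadic (rightNeighbor i)) /
        ENNReal.ofReal (2 ^ i.1.1)) ^ p) x with hH
    have hHm : ∀ n, Measurable (H n) := fun n => Measurable.iSup fun i =>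
      measurable_const.indicator (measurableSet_dyadic _)
    have hpt : ∀ x, N K x ≤ ∑' n : ℤ, ((2 : ℝ≥0∞) ^ (n + 2)) ^ p * H n x := by
      intro x
      refine iSup_le fun i => ?_
      by_cases hx : x ∈ dyadic i.1
      swap
      · rw [indicator_of_notMem hx]; exact zero_le
      rw [indicator_of_mem hx]
      set m := μ (dyadic (rightNeighbor i))
      set v := ν (dyadic (rightNeighbor i))
      have hmtop : m ≠ ∞ := dyadic_measure_ne_top μ _
      rcases eq_or_ne m 0 with hm | hm
      · have : v = 0 := withDensity_absolutelyContinuous μ F hm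
        rw [this, ENNReal.zero_div, ENNReal.zero_rpow_of_pos hp0]
        exact zero_le
      -- The average is split into the `μ`-average of `F`, which determines the level `n`, and the
      -- average of `μ`, which testing controls.
      calc (v / ENNReal.ofReal (2 ^ i.1.1)) ^ p
          = (v / m) ^ p * (m / ENNReal.ofReal (2 ^ i.1.1)) ^ p := by
            rw [← ENNReal.mul_rpow_of_nonneg _ _ hp0.le, ← mul_div_assoc,
              ENNReal.div_mul_cancel hm hmtop]
        _ ≤ (∑' n : ℤ, (if (2 : ℝ≥0∞) ^ (n + 1) < v / m then ((2 : ℝ≥0∞) ^ (n + 2)) ^ p else 0)) *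
            (m / ENNReal.ofReal (2 ^ i.1.1)) ^ p := by
            gcongr; exact ENNReal.rpow_le_tsum_two_zpow hp0 _
        _ ≤ _ := by
            rw [← ENNReal.tsum_mul_right]
            refine ENNReal.tsum_le_tsum fun n => ?_
            split_ifs with hn
            · gcongr
              rw [ENNReal.lt_div_iff_mul_lt (.inl hm) (.inl hmtop)] at hn
              refine le_trans ?_ (le_iSup _ ⟨i.1, i.2, hn⟩)
              rw [indicator_of_mem hx]
            · simp
    -- The level bounds carry weights `2^{np} 2^{-n} = 2^{n(p-1)}` up to constants. After exchanging
    -- sum and integral, the levels with `2^n < F x` form a geometric series of size `F(x)^{p-1}`,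
    -- because `p > 1`.
    calc ∫⁻ x, N K x ∂ω ≤ ∫⁻ x, ∑' n : ℤ, ((2 : ℝ≥0∞) ^ (n + 2)) ^ p * H n x ∂ω :=
          lintegral_mono hpt
      _ = ∑' n : ℤ, ((2 : ℝ≥0∞) ^ (n + 2)) ^ p * ∫⁻ x, H n x ∂ω := by
          rw [lintegral_tsum fun n => ((hHm n).const_mul _).aemeasurable]
          simp_rw [lintegral_const_mul _ (hHm _)]
      _ ≤ ∑' n : ℤ, (4 ^ p * 2 ^ p) * T * (∫⁻ x,
            F x * (if (2 : ℝ≥0∞) ^ n < F x then ((2 : ℝ≥0∞) ^ n) ^ (p - 1) else 0) ∂μ) := by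
          refine ENNReal.tsum_le_tsum fun n => ?_
          have h2n : (2 : ℝ≥0∞) ^ n ≠ ∞ := (ENNReal.zpow_lt_top (by norm_num) (by norm_num) _).ne
          have h2n0 : (2 : ℝ≥0∞) ^ n ≠ 0 := (ENNReal.zpow_pos (by norm_num) (by norm_num) _).ne'
          calc ((2 : ℝ≥0∞) ^ (n + 2)) ^ p * ∫⁻ x, H n x ∂ω
              ≤ ((2 : ℝ≥0∞) ^ (n + 2)) ^ p * (2 ^ p * T * ((2 : ℝ≥0∞) ^ (-n) *
                ∫⁻ x in {x | (2 : ℝ≥0∞) ^ n < F x}, F x ∂μ)) := by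
                gcongr
                exact lintegral_iSup_level_le hp hT hF K n
            _ = (4 ^ p * 2 ^ p) * T * (((2 : ℝ≥0∞) ^ n) ^ (p - 1) *
                ∫⁻ x in {x | (2 : ℝ≥0∞) ^ n < F x}, F x ∂μ) := by
                rw [ENNReal.rpow_sub _ _ h2n0 h2n, ENNReal.rpow_one,
                  ENNReal.zpow_add (by norm_num) (by norm_num),
                  ENNReal.mul_rpow_of_nonneg _ _ hp0.le, ENNReal.zpow_neg, div_eq_mul_inv]
                norm_num
                ring
            _ = _ := by
                congr 1
                rw [← lintegral_const_mul _ hF,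
                  ← lintegral_indicator (measurableSet_lt measurable_const hF)]
                congr 1 with x
                by_cases hx : (2 : ℝ≥0∞) ^ n < F x
                · rw [indicator_of_mem (by exact hx), if_pos hx, mul_comm]
                · rw [indicator_of_notMem (by exact hx), if_neg hx, mul_zero]
      _ = (4 ^ p * 2 ^ p) * T * ∫⁻ x, F x * ∑' n : ℤ,
            (if (2 : ℝ≥0∞) ^ n < F x then ((2 : ℝ≥0∞) ^ n) ^ (p - 1) else 0) ∂μ := by
          rw [ENNReal.tsum_mul_left, ← lintegral_tsum]
          · simp_rw [ENNReal.tsum_mul_left]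
          · intro n
            exact (hF.mul (Measurable.ite (measurableSet_lt measurable_const hF) measurable_const
              measurable_const)).aemeasurable
      _ ≤ (4 ^ p * 2 ^ p) * T * ∫⁻ x, C * F x ^ p ∂μ := by
          refine mul_le_mul_right (lintegral_mono fun x => ?_) _
          calc F x * ∑' n : ℤ, (if (2 : ℝ≥0∞) ^ n < F x then ((2 : ℝ≥0∞) ^ n) ^ (p - 1) else 0)
              ≤ F x * (C * F x ^ (p - 1)) := by gcongr; exact hsum _
            _ = C * F x ^ p := by
              have : F x ^ p = F x ^ (1 : ℝ) * F x ^ (p - 1) := by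
                rw [← ENNReal.rpow_add_of_nonneg _ _ zero_le_one (by linarith)]
                congr 1; ring
              rw [this, ENNReal.rpow_one]; ring
      _ = _ := by
          rw [lintegral_const_mul _ (hF.pow_const _)]; ring
  calc ∫⁻ x, maxMeas ν x ^ p ∂ω ≤ ∫⁻ x, 4 ^ p * ⨆ K, N K x ∂ω := lintegral_mono hle
    _ = 4 ^ p * ⨆ K, ∫⁻ x, N K x ∂ω := by
        rw [lintegral_const_mul _ (Measurable.iSup hNm), lintegral_iSup hNm hmono]
    _ ≤ 4 ^ p * ((4 ^ p * 2 ^ p) * C * T * ∫⁻ x, F x ^ p ∂μ) := by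
        gcongr; exact iSup_le hlevel
    _ = _ := by ring

/-! ### From local to global testing -/

/-- The sets `A ∩ Ioi u` with `u ∈ A` exhaust `A` except for a possible least element, which is
null. Rational cut points make the directed union countable. This replaces taking the infimum of a
level set, which need not belong to it. -/
theorem setLIntegral_le_of_forall_inter_Ioi {ω : Measure ℝ} [NullSingletonClass ω] {A : Set ℝ}
    {f : ℝ → ℝ≥0∞} {K : ℝ≥0∞} (h : ∀ u ∈ A, ∫⁻ x in A ∩ Ioi u, f x ∂ω ≤ K) :
    ∫⁻ x in A, f x ∂ω ≤ K := by
  set s : {q : ℚ // ∃ u ∈ A, u < (q : ℝ)} → Set ℝ := fun q => A ∩ Ioi (q : ℝ)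
  have hnull : ω {x ∈ A | ∀ u ∈ A, x ≤ u} = 0 := by
    refine Set.Subsingleton.measure_zero ?_ ω
    intro x hx y hy
    exact le_antisymm (hx.2 y hy.1) (hy.2 x hx.1)
  have hcov : A ⊆ {x ∈ A | ∀ u ∈ A, x ≤ u} ∪ ⋃ q, s q := by
    intro x hx
    by_cases hmin : ∀ u ∈ A, x ≤ u
    · exact .inl ⟨hx, hmin⟩
    · push Not at hmin
      obtain ⟨u, hu, hux⟩ := hmin
      obtain ⟨q, hq1, hq2⟩ := exists_rat_btwn hux
      exact .inr (mem_iUnion.2 ⟨⟨q, u, hu, hq1⟩, hx, hq2⟩)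
  have hdir : Directed (· ⊆ ·) s := by
    have hanti : ∀ q r, q ≤ r → s r ⊆ s q := fun q r hqr x hx =>
      ⟨hx.1, lt_of_le_of_lt (by exact_mod_cast hqr : ((q : ℚ) : ℝ) ≤ (r : ℚ)) hx.2⟩
    intro q r
    rcases le_total q r with h | h
    · exact ⟨q, Subset.rfl, hanti _ _ h⟩
    · exact ⟨r, hanti _ _ h, Subset.rfl⟩
  calc ∫⁻ x in A, f x ∂ω ≤ ∫⁻ x in {x ∈ A | ∀ u ∈ A, x ≤ u} ∪ ⋃ q, s q, f x ∂ω :=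
        lintegral_mono_set hcov
    _ ≤ (∫⁻ x in {x ∈ A | ∀ u ∈ A, x ≤ u}, f x ∂ω) + ∫⁻ x in ⋃ q, s q, f x ∂ω :=
        lintegral_union_le _ _ _
    _ ≤ 0 + K := by
        gcongr
        · exact (setLIntegral_measure_zero _ _ hnull).le
        · rw [setLIntegral_iUnion_of_directed _ hdir]
          refine iSup_le fun ⟨q, u, hu, huq⟩ => le_trans (lintegral_mono_set ?_) (h u hu)
          exact fun x hx => ⟨hx.1, huq.trans hx.2⟩
    _ = K := zero_add K

/-- A window from `x` that reaches into `(c,d)` contains all of `(x,c]`, whose mass is at least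
`(2^m - 1) μ(c,d)`. Its total mass is therefore at least `2^m` times its mass inside `(c,d)`. -/
theorem two_pow_mul_maxMeas_restrict_le {μ : Measure ℝ} [IsLocallyFiniteMeasure μ] {c d x : ℝ}
    (hcd : c < d) (hxc : x < c) (m : ℕ) (hm : 2 ^ m * μ (Ioo c d) ≤ μ (Ioo x d)) :
    2 ^ m * maxMeas (μ.restrict (Ioo c d)) x ≤ maxMeas (μ.restrict (Ioo x d)) x := by
  have h2 : (2 : ℝ≥0∞) ^ m ≠ 0 := by positivity
  have h2' : (2 : ℝ≥0∞) ^ m ≠ ∞ := by simp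
  have hfin : μ (Ioo c d) ≠ ∞ :=
    ((measure_mono Ioo_subset_Icc_self).trans_lt isCompact_Icc.measure_lt_top).ne
  obtain ⟨k, hk⟩ : ∃ k : ℕ, (2 : ℝ≥0∞) ^ m = k + 1 := by
    obtain ⟨k, hk⟩ := Nat.exists_eq_add_of_le (Nat.one_le_two_pow (n := m))
    exact ⟨k, by exact_mod_cast hk.trans (add_comm _ _)⟩
  have hsplit : ∀ e, c < e → μ (Ioo x e) = μ (Ioc x c) + μ (Ioo c e) := by
    intro e he
    rw [← Ioc_union_Ioo_eq_Ioo hxc.le he, measure_union _ measurableSet_Ioo]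
    exact Set.disjoint_left.2 fun y hy hy' => not_lt.2 hy.2 hy'.1
  have hP : k * μ (Ioo c d) ≤ μ (Ioc x c) := by
    rw [hsplit d hcd, hk, add_mul, one_mul] at hm
    exact (ENNReal.add_le_add_iff_right hfin).1 hm
  rw [mul_comm, ← ENNReal.le_div_iff_mul_le (.inl h2) (.inl h2')]
  refine maxMeas_le fun h hh => ?_
  rw [← ENNReal.mul_div_right_comm, ENNReal.le_div_iff_mul_le (.inl h2) (.inl h2')]
  refine le_trans ?_ (measure_Ioo_le_maxMeas _ x hh)
  rw [Measure.restrict_apply measurableSet_Ioo, Measure.restrict_apply measurableSet_Ioo,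
    Ioo_inter_Ioo, Ioo_inter_Ioo, max_self, max_eq_right hxc.le]
  rcases le_or_gt (min (x + h) d) c with he | he
  · rw [Ioo_eq_empty (not_lt.2 he)]; simp
  · rw [hsplit _ he, hk, mul_add, mul_one, mul_comm]
    gcongr
    refine le_trans ?_ hP
    gcongr
    exact min_le_right _ _

/-- Local testing implies global testing for the one-sided maximal function. -/
theorem exists_lintegral_maxMeas_restrict_le {p : ℝ} (hp : 1 < p) :
    ∃ C : ℝ≥0∞, C ≠ ∞ ∧ ∀ (μ ω : Measure ℝ) [IsLocallyFiniteMeasure μ] [NullSingletonClass ω] (T : ℝ≥0∞),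
      (∀ a b, a < b → ∫⁻ x in Ioo a b, maxMeas (μ.restrict (Ioo a b)) x ^ p ∂ω ≤
        T * μ (Ioo a b)) →
      ∀ c d, c < d → ∫⁻ x, maxMeas (μ.restrict (Ioo c d)) x ^ p ∂ω ≤ C * T * μ (Ioo c d) := by
  have hp0 : 0 < p := by linarith
  have hr : (2 : ℝ≥0∞) ^ (1 - p) < 1 :=
    ENNReal.rpow_lt_one_of_one_lt_of_neg (by norm_num) (by linarith)
  refine ⟨2 * (1 - (2 : ℝ≥0∞) ^ (1 - p))⁻¹ + 1, ?_, fun μ ω _ _ T hT c d hcd => ?_⟩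
  · exact ENNReal.add_ne_top.2 ⟨ENNReal.mul_ne_top (by norm_num)
      (ENNReal.inv_ne_top.2 (tsub_pos_iff_lt.2 hr).ne'), by norm_num⟩
  have hfin : ∀ a b, μ (Ioo a b) ≠ ∞ := fun a b =>
    ((measure_mono Ioo_subset_Icc_self).trans_lt isCompact_Icc.measure_lt_top).ne
  rcases eq_or_ne (μ (Ioo c d)) 0 with h0 | h0
  · rw [Measure.restrict_eq_zero.2 h0]
    simp [maxMeas_zero, hp0]
  set S := μ (Ioo c d) with hS
  set f : ℝ → ℝ≥0∞ := fun x => maxMeas (μ.restrict (Ioo c d)) x ^ p with hf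
  have hright : ∫⁻ x in Ici c, f x ∂ω ≤ T * S := by
    rw [setLIntegral_congr Ioi_ae_eq_Ici.symm, ← lintegral_inter_add_sdiff _ _ measurableSet_Iio (B := Iio d),
      Ioi_inter_Iio, setLIntegral_eq_zero (measurableSet_Ioi.diff measurableSet_Iio), add_zero]
    · exact hT c d hcd
    · intro x hx
      have : maxMeas (μ.restrict (Ioo c d)) x = 0 := by
        refine le_antisymm (maxMeas_le fun h hh => ?_) zero_le
        rw [Measure.restrict_apply measurableSet_Ioo, Ioo_inter_Ioo, Ioo_eq_empty]
        · simp
        · have : d ≤ x := not_lt.1 hx.2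
          simp only [lt_min_iff, max_lt_iff, not_and_or]
          right; left; exact not_lt.2 this
      simp [hf, this, hp0]
  -- The points left of `c` are sorted by the ratio of `μ(x,d)` to `μ(c,d)`. Local testing on
  -- `(u,d)` with `u ∈ A m` costs `2^(m+1)` and gains `2^(mp)`.
  set A : ℕ → Set ℝ := fun m => {x | x < c ∧ 2 ^ m * S ≤ μ (Ioo x d) ∧ μ (Ioo x d) < 2 ^ (m + 1) * S}
    with hA
  have hcov : Iio c ⊆ ⋃ m, A m := by
    intro x hx
    have h1 : S ≤ μ (Ioo x d) := measure_mono (Ioo_subset_Ioo_left (le_of_lt hx))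
    have h2 : 1 ≤ μ (Ioo x d) / S := by
      rwa [ENNReal.le_div_iff_mul_le (.inl h0) (.inl (hfin _ _)), one_mul]
    obtain ⟨n, hn1, hn2⟩ := ENNReal.exists_mem_Ico_zpow (x := μ (Ioo x d) / S) (y := 2)
      (by positivity) (ENNReal.div_ne_top (hfin _ _) h0) (by norm_num) (by norm_num)
    have hn : 0 ≤ n := by
      by_contra hcon
      have := ENNReal.zpow_le_of_le (by norm_num : (1 : ℝ≥0∞) ≤ 2) (by omega : n + 1 ≤ 0)
      rw [zpow_zero] at this
      exact absurd (hn2.trans_le this) (not_lt.2 h2)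
    lift n to ℕ using hn
    rw [zpow_natCast, ENNReal.le_div_iff_mul_le (.inl h0) (.inl (hfin _ _))] at hn1
    rw [show (n : ℤ) + 1 = ((n + 1 : ℕ) : ℤ) by push_cast; rfl, zpow_natCast,
      ENNReal.div_lt_iff (.inl h0) (.inl (hfin _ _))] at hn2
    exact mem_iUnion.2 ⟨n, hx, hn1, hn2⟩
  have hlevel : ∀ m, ∫⁻ x in A m, f x ∂ω ≤ 2 * ((2 : ℝ≥0∞) ^ (1 - p)) ^ m * (T * S) := by
    intro m
    refine setLIntegral_le_of_forall_inter_Ioi fun u hu => ?_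
    have h2 : ((2 : ℝ≥0∞) ^ m) ^ p ≠ 0 := by
      simp [ENNReal.rpow_eq_zero_iff, hp0]
    have h2' : ((2 : ℝ≥0∞) ^ m) ^ p ≠ ∞ := ENNReal.rpow_ne_top_of_nonneg hp0.le (by simp)
    have hkey : ((2 : ℝ≥0∞) ^ m) ^ p * ∫⁻ x in A m ∩ Ioi u, f x ∂ω ≤ T * (2 ^ (m + 1) * S) := by
      rw [← lintegral_const_mul _ ((measurable_maxMeas _).pow_const _)]
      calc ∫⁻ x in A m ∩ Ioi u, ((2 : ℝ≥0∞) ^ m) ^ p * f x ∂ω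
          ≤ ∫⁻ x in A m ∩ Ioi u, maxMeas (μ.restrict (Ioo u d)) x ^ p ∂ω := by
            refine setLIntegral_mono ((measurable_maxMeas _).pow_const _) fun x hx => ?_
            rw [hf, ← ENNReal.mul_rpow_of_nonneg _ _ hp0.le]
            gcongr
            refine (two_pow_mul_maxMeas_restrict_le hcd hx.1.1 m hx.1.2.1).trans
              (maxMeas_mono (Measure.restrict_mono (Ioo_subset_Ioo_left (le_of_lt hx.2)) le_rfl) x)
        _ ≤ ∫⁻ x in Ioo u d, maxMeas (μ.restrict (Ioo u d)) x ^ p ∂ω :=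
            lintegral_mono_set fun x hx => ⟨hx.2, hx.1.1.trans hcd⟩
        _ ≤ T * μ (Ioo u d) := hT u d (hu.1.trans hcd)
        _ ≤ _ := by gcongr; exact hu.2.2.le
    rw [mul_comm, ← ENNReal.le_div_iff_mul_le (.inl h2) (.inl h2')] at hkey
    refine hkey.trans_eq ?_
    have : ((2 : ℝ≥0∞) ^ (1 - p)) ^ m = 2 ^ m * (((2 : ℝ≥0∞) ^ m) ^ p)⁻¹ := by
      rw [← ENNReal.rpow_natCast, ← ENNReal.rpow_natCast, ← ENNReal.rpow_mul, ← ENNReal.rpow_mul,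
        ← ENNReal.rpow_neg, ← ENNReal.rpow_add _ _ (by norm_num) (by norm_num)]
      congr 1; ring
    rw [this, div_eq_mul_inv, pow_succ]
    ring
  calc ∫⁻ x, f x ∂ω = (∫⁻ x in Iio c, f x ∂ω) + ∫⁻ x in Ici c, f x ∂ω := by
        rw [← compl_Iio, lintegral_add_compl _ measurableSet_Iio]
    _ ≤ (∑' m, ∫⁻ x in A m, f x ∂ω) + T * S := by
        gcongr
        exact (lintegral_mono_set hcov).trans (lintegral_iUnion_le _ _)
    _ ≤ (∑' m, 2 * ((2 : ℝ≥0∞) ^ (1 - p)) ^ m * (T * S)) + T * S := by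
        gcongr with m; exact hlevel m
    _ = _ := by
        rw [ENNReal.tsum_mul_right, ENNReal.tsum_mul_left, ENNReal.tsum_geometric]
        ring

/-! ### Young functions and Luxemburg averages -/

theorem IsYoung.monotone {Φ : ℝ≥0 → ℝ≥0} (hΦ : IsYoung Φ) : Monotone Φ := by
  intro s t hst
  rcases eq_or_ne t 0 with rfl | ht
  · rw [le_antisymm hst zero_le]
  have h1 : s / t ≤ 1 := div_le_one_of_le₀ hst zero_le
  have h := hΦ.convex.2 (mem_univ t) (mem_univ 0) (zero_le (a := s / t)) (zero_le (a := 1 - s / t))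
    (add_tsub_cancel_of_le h1)
  simp only [smul_eq_mul, hΦ.map_zero, mul_zero, add_zero, div_mul_cancel₀ _ ht] at h
  exact h.trans (mul_le_of_le_one_left zero_le h1)

theorem le_youngInv {Φ : ℝ≥0 → ℝ≥0} (hΦ : IsYoung Φ) {s t : ℝ≥0} (h : Φ s ≤ t) :
    (s : ℝ≥0∞) ≤ youngInv Φ t := by
  refine le_iInf₂ fun r hr => ?_
  rw [ENNReal.coe_le_coe]
  by_contra hcon
  exact absurd (hr.trans_le (hΦ.monotone (not_le.1 hcon).le)) (not_lt.2 h)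

/-- Young's inequality for a complementary pair of Young functions. -/
theorem young_mul_le {Φ Ψ : ℝ≥0 → ℝ≥0} (hΦ : IsYoung Φ) (hΨ : IsYoung Ψ) {κ : ℝ≥0}
    (h : ∀ t : ℝ≥0, 0 < t → youngInv Φ t * youngInv Ψ t ≤ (κ : ℝ≥0∞) * (t : ℝ≥0∞)) (s t : ℝ≥0) :
    s * t ≤ κ * (Φ s + Ψ t) := by
  have key : ∀ u : ℝ≥0, 0 < u → Φ s ≤ u → Ψ t ≤ u → s * t ≤ κ * u := fun u hu h1 h2 => by
    have := (mul_le_mul' (le_youngInv hΦ h1) (le_youngInv hΨ h2)).trans (h u hu)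
    exact_mod_cast this
  rcases eq_or_ne (Φ s + Ψ t) 0 with h0 | h0
  · rw [h0, mul_zero]
    have h1 : Φ s = 0 := (add_eq_zero.1 h0).1
    have h2 : Ψ t = 0 := (add_eq_zero.1 h0).2
    -- The inverse functions are controlled only at positive arguments, so when `Φ s + Ψ t = 0` the
    -- value `u` is sent to 0.
    refine le_of_forall_pos_le_add fun ε hε => ?_
    have hk : (0 : ℝ≥0) < ε / (κ + 1) := by positivity
    refine (key _ hk (by rw [h1]; exact zero_le) (by rw [h2]; exact zero_le)).trans ?_
    rw [zero_add, mul_div_left_comm]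
    refine mul_le_of_le_one_right zero_le (div_le_one_of_le₀ ?_ zero_le)
    exact le_self_add
  · exact key _ (pos_iff_ne_zero.2 h0) le_self_add le_add_self

section Orlicz

variable {Φ Ψ : ℝ≥0 → ℝ≥0} {κ : ℝ≥0} {a b : ℝ} {f g : ℝ → ℝ}

theorem aemeasurable_comp_nnnorm_div (hΦ : IsYoung Φ) {μ : Measure ℝ} (hf : AEMeasurable f μ)
    (r : ℝ≥0) : AEMeasurable (fun x => (Φ (‖f x‖₊ / r) : ℝ≥0∞)) μ :=
  (hΦ.continuous.measurable.comp_aemeasurable (hf.nnnorm.div_const r)).coe_nnreal_ennreal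

/-- Young's inequality with second argument 1. It serves to show that a vanishing Luxemburg average
forces `f = 0` almost everywhere, which settles the `0 · ∞` cases of Hölder's inequality. -/
theorem lintegral_div_le_mul_luxAvg (hab : a < b) (h : ∀ s t, s * t ≤ κ * (Φ s + Ψ t)) :
    (∫⁻ x in Ioo a b, ‖f x‖ₑ) / ENNReal.ofReal (b - a) ≤ (κ * (1 + Ψ 1) : ℝ≥0) * luxAvg Φ f a b := by
  have hκ : κ ≠ 0 := fun h0 => by simpa [h0] using h 1 1
  have hc : κ * (1 + Ψ 1) ≠ 0 := mul_ne_zero hκ (by positivity)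
  have hl : ENNReal.ofReal (b - a) ≠ 0 := by simpa using hab
  rw [mul_comm, ← ENNReal.div_le_iff (by simpa using hc) ENNReal.coe_ne_top]
  refine le_iInf fun r => le_iInf fun hr => le_iInf fun hadm => ?_
  rw [ENNReal.div_le_iff hl ENNReal.ofReal_ne_top, one_mul] at hadm
  rw [ENNReal.div_le_iff (by simpa using hc) ENNReal.coe_ne_top,
    ENNReal.div_le_iff hl ENNReal.ofReal_ne_top]
  calc ∫⁻ x in Ioo a b, ‖f x‖ₑ ≤ ∫⁻ x in Ioo a b, (r * κ : ℝ≥0) * ((Φ (‖f x‖₊ / r) : ℝ≥0∞) + Ψ 1) := by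
        refine lintegral_mono fun x => ?_
        have h1 := h (‖f x‖₊ / r) 1
        rw [mul_one, div_le_iff₀ hr] at h1
        have h2 : ‖f x‖₊ ≤ r * κ * (Φ (‖f x‖₊ / r) + Ψ 1) := h1.trans_eq (by ring)
        rw [enorm_eq_nnnorm]
        rw [← ENNReal.coe_add, ← ENNReal.coe_mul, ENNReal.coe_le_coe]
        exact h2
    _ = (r * κ : ℝ≥0) * ((∫⁻ x in Ioo a b, (Φ (‖f x‖₊ / r) : ℝ≥0∞)) + Ψ 1 * ENNReal.ofReal (b - a)) := by
        rw [lintegral_const_mul' _ _ ENNReal.coe_ne_top, lintegral_add_right _ measurable_const,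
          setLIntegral_const, Real.volume_Ioo]
    _ ≤ (r * κ : ℝ≥0) * (ENNReal.ofReal (b - a) + Ψ 1 * ENNReal.ofReal (b - a)) := by gcongr
    _ = _ := by push_cast; ring

theorem ae_eq_zero_of_luxAvg_eq_zero (hab : a < b)
    (h : ∀ s t, s * t ≤ κ * (Φ s + Ψ t)) (hf : AEMeasurable f volume) (h0 : luxAvg Φ f a b = 0) :
    ∀ᵐ x ∂volume.restrict (Ioo a b), ‖f x‖ₑ = 0 := by
  have h1 := lintegral_div_le_mul_luxAvg hab h (f := f)
  rw [h0, mul_zero, nonpos_iff_eq_zero, ENNReal.div_eq_zero_iff] at h1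
  exact (lintegral_eq_zero_iff' hf.enorm.restrict).1 (h1.resolve_right ENNReal.ofReal_ne_top)

/-- Hölder's inequality for Luxemburg averages. -/
theorem lintegral_mul_div_le_luxAvg_mul_luxAvg (hab : a < b) (hΦ : IsYoung Φ)
    (h : ∀ s t, s * t ≤ κ * (Φ s + Ψ t)) (hf : AEMeasurable f volume)
    (hg : AEMeasurable g volume) :
    (∫⁻ x in Ioo a b, ‖f x‖ₑ * ‖g x‖ₑ) / ENNReal.ofReal (b - a) ≤
      2 * κ * (luxAvg Φ f a b * luxAvg Ψ g a b) := by
  have hκ : κ ≠ 0 := fun h0 => by simpa [h0] using h 1 1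
  have hκ2 : (2 : ℝ≥0∞) * κ ≠ 0 := by simpa using hκ
  have hκ2' : (2 : ℝ≥0∞) * κ ≠ ∞ := ENNReal.mul_ne_top (by simp) (by simp)
  have hl : ENNReal.ofReal (b - a) ≠ 0 := by simpa using hab
  have h' : ∀ s t, s * t ≤ κ * (Ψ s + Φ t) := fun s t => by
    rw [mul_comm s, add_comm]; exact h t s
  have hadm : ∀ r s : ℝ≥0, 0 < r → 0 < s →
      (∫⁻ x in Ioo a b, (Φ (‖f x‖₊ / r) : ℝ≥0∞)) / ENNReal.ofReal (b - a) ≤ 1 →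
      (∫⁻ x in Ioo a b, (Ψ (‖g x‖₊ / s) : ℝ≥0∞)) / ENNReal.ofReal (b - a) ≤ 1 →
      (∫⁻ x in Ioo a b, ‖f x‖ₑ * ‖g x‖ₑ) / ENNReal.ofReal (b - a) ≤ r * (2 * κ * s) := by
    intro r s hr hs h1 h2
    rw [ENNReal.div_le_iff hl ENNReal.ofReal_ne_top, one_mul] at h1 h2
    rw [ENNReal.div_le_iff hl ENNReal.ofReal_ne_top]
    calc ∫⁻ x in Ioo a b, ‖f x‖ₑ * ‖g x‖ₑ
        ≤ ∫⁻ x in Ioo a b, (r * s * κ : ℝ≥0) * ((Φ (‖f x‖₊ / r) : ℝ≥0∞) + Ψ (‖g x‖₊ / s)) := by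
          refine lintegral_mono fun x => ?_
          have h3 := mul_le_mul_right (h (‖f x‖₊ / r) (‖g x‖₊ / s)) (r * s)
          have h4 : ‖f x‖₊ * ‖g x‖₊ ≤ r * s * κ * (Φ (‖f x‖₊ / r) + Ψ (‖g x‖₊ / s)) := by
            calc ‖f x‖₊ * ‖g x‖₊ = r * s * (‖f x‖₊ / r * (‖g x‖₊ / s)) := by
                  field_simp
              _ ≤ _ := h3
              _ = _ := by ring
          rw [enorm_eq_nnnorm, enorm_eq_nnnorm]
          rw [← ENNReal.coe_add, ← ENNReal.coe_mul, ← ENNReal.coe_mul, ENNReal.coe_le_coe]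
          exact h4
      _ = (r * s * κ : ℝ≥0) * ((∫⁻ x in Ioo a b, (Φ (‖f x‖₊ / r) : ℝ≥0∞)) +
            ∫⁻ x in Ioo a b, (Ψ (‖g x‖₊ / s) : ℝ≥0∞)) := by
          rw [lintegral_const_mul' _ _ ENNReal.coe_ne_top,
            lintegral_add_left' (aemeasurable_comp_nnnorm_div hΦ hf.restrict r)]
      _ ≤ (r * s * κ : ℝ≥0) * (ENNReal.ofReal (b - a) + ENNReal.ofReal (b - a)) := by gcongr
      _ = _ := by push_cast; ring
  have hzero : luxAvg Φ f a b = 0 ∨ luxAvg Ψ g a b = 0 →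
      (∫⁻ x in Ioo a b, ‖f x‖ₑ * ‖g x‖ₑ) / ENNReal.ofReal (b - a) = 0 := by
    intro h0
    have hm : AEMeasurable (fun x => ‖f x‖ₑ * ‖g x‖ₑ) (volume.restrict (Ioo a b)) :=
      hf.enorm.restrict.mul hg.enorm.restrict
    rw [(lintegral_eq_zero_iff' hm).2, ENNReal.zero_div]
    rcases h0 with h0 | h0
    · filter_upwards [ae_eq_zero_of_luxAvg_eq_zero hab h hf h0] with x hx
      simp [hx]
    · filter_upwards [ae_eq_zero_of_luxAvg_eq_zero hab h' hg h0] with x hx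
      simp [hx]
  by_cases hA : luxAvg Φ f a b = 0
  · rw [hzero (.inl hA)]; exact zero_le
  by_cases hB : luxAvg Ψ g a b = 0
  · rw [hzero (.inr hB)]; exact zero_le
  by_cases hA' : luxAvg Φ f a b = ∞
  · rw [hA', ENNReal.top_mul hB, ENNReal.mul_top hκ2]; exact le_top
  have hC : 2 * (κ : ℝ≥0∞) * luxAvg Φ f a b ≠ 0 := mul_ne_zero hκ2 hA
  have hC' : 2 * (κ : ℝ≥0∞) * luxAvg Φ f a b ≠ ∞ := ENNReal.mul_ne_top hκ2' hA'
  rw [← mul_assoc, mul_comm, ← ENNReal.div_le_iff hC hC']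
  refine le_iInf fun s => le_iInf fun hs => le_iInf fun hsa => ?_
  have hD : 2 * (κ : ℝ≥0∞) * s ≠ 0 := mul_ne_zero hκ2 (by simpa using hs.ne')
  have hD' : 2 * (κ : ℝ≥0∞) * s ≠ ∞ := ENNReal.mul_ne_top hκ2' ENNReal.coe_ne_top
  rw [ENNReal.div_le_iff hC hC',
    show (s : ℝ≥0∞) * (2 * κ * luxAvg Φ f a b) = luxAvg Φ f a b * (2 * κ * s) by ring,
    ← ENNReal.div_le_iff hD hD']
  refine le_iInf fun r => le_iInf fun hr => le_iInf fun hra => ?_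
  rw [ENNReal.div_le_iff hD hD']
  exact hadm r s hr hs hra hsa

/-- Since `Ψ 0 = 0`, only `(b,c)` contributes to the integral on the left, and `(y,c)` contains
`(b,c)` but is no longer than `(a,c)`. So any admissible `r` for the left side is admissible on the
smaller interval only if the lengths are compared the other way: admissibility over `(y,c)` passes
to `(a,c)`. -/
theorem luxAvg_indicator_le (hΨ : Ψ 0 = 0) {a b c y : ℝ} (hay : a ≤ y) (hyb : y ≤ b)
    (g : ℝ → ℝ) : luxAvg Ψ ((Ioo b c).indicator g) a c ≤ luxAvg Ψ g y c := by
  refine le_iInf fun r => le_iInf fun hr => le_iInf fun hra => ?_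
  refine iInf_le_of_le r (iInf_le_of_le hr (iInf_le_of_le (le_trans ?_ hra) le_rfl))
  refine ENNReal.div_le_div ?_ (ENNReal.ofReal_le_ofReal (by linarith))
  have : ∀ x, (Ψ (‖(Ioo b c).indicator g x‖₊ / r) : ℝ≥0∞) =
      (Ioo b c).indicator (fun x => (Ψ (‖g x‖₊ / r) : ℝ≥0∞)) x := by
    intro x
    by_cases hx : x ∈ Ioo b c
    · rw [indicator_of_mem hx, indicator_of_mem hx]
    · rw [indicator_of_notMem hx, indicator_of_notMem hx]; simp [hΨ]
  simp_rw [this]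
  rw [setLIntegral_indicator measurableSet_Ioo]
  exact lintegral_mono_set fun x hx => ⟨hyb.trans_lt hx.1.1, hx.1.2⟩

theorem luxAvg_indicator_le_maxPlusYoung (hΨ : Ψ 0 = 0) {a b c y : ℝ} (hay : a ≤ y) (hyb : y < b)
    (hbc : b < c) (g : ℝ → ℝ) : luxAvg Ψ ((Ioo b c).indicator g) a c ≤ maxPlusYoung Ψ g y := by
  refine (luxAvg_indicator_le hΨ hay hyb.le g).trans ?_
  have := le_iSup₂ (f := fun (h : ℝ) (_ : 0 < h) => luxAvg Ψ g y (y + h)) (c - y) (by linarith)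
  simp only [add_sub_cancel] at this
  exact this

end Orlicz

/-! ### Weights and the bump condition -/

theorem IsWeight.aemeasurable {w : ℝ → ℝ≥0} (hw : IsWeight w) : AEMeasurable w volume := by
  have := hw.aestronglyMeasurable.aemeasurable.real_toNNReal
  simpa using this

theorem IsWeight.isLocallyFiniteMeasure {w : ℝ → ℝ≥0} (hw : IsWeight w) :
    IsLocallyFiniteMeasure (weightMeasure w) := by
  refine ⟨fun x => ?_⟩
  obtain ⟨u, hu, hui⟩ := hw x
  obtain ⟨v, hvu, hv, hxv⟩ := mem_nhds_iff.1 hu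
  refine ⟨v, hv.mem_nhds hxv, ?_⟩
  rw [weightMeasure, withDensity_apply _ hv.measurableSet]
  refine (lintegral_mono_set hvu).trans_lt ?_
  have := hui.2
  simpa [HasFiniteIntegral, enorm_eq_nnnorm] using this

/-- The joint use of the bump condition and Hölder's inequality. -/
theorem weightMeasure_mul_rpow_le {p : ℝ} (hp : 1 < p) {Φ Ψ : ℝ≥0 → ℝ≥0} {κ : ℝ≥0}
    (hΦ : IsYoung Φ) (h : ∀ s t, s * t ≤ κ * (Φ s + Ψ t)) (w : ℝ → ℝ≥0)
    {σ : ℝ → ℝ≥0} (hσ : AEMeasurable σ volume) {J : Set ℝ} (hJ : MeasurableSet J) {a b c : ℝ}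
    (hab : a < b) (hbc : b < c) :
    weightMeasure w (Ioo a b) * (weightMeasure σ (J ∩ Ioo b c) / ENNReal.ofReal (c - a)) ^ p ≤
      (2 * κ) ^ p * (bumpConst p w σ Φ * ENNReal.ofReal (c - a)) *
        luxAvg Ψ ((Ioo b c).indicator (J.indicator fun y => ((σ y ^ (1 / p) : ℝ≥0) : ℝ))) a c ^ p := by
  have hp0 : 0 < p := by linarith
  have hac : a < c := by linarith
  set f : ℝ → ℝ := (Ioo b c).indicator fun y => ((σ y ^ (1 / p.conjExponent) : ℝ≥0) : ℝ) with hf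
  set g : ℝ → ℝ := J.indicator fun y => ((σ y ^ (1 / p) : ℝ≥0) : ℝ) with hg
  have hfm : AEMeasurable f volume := (hσ.pow_const _).coe_nnreal_real.indicator measurableSet_Ioo
  have hgm : AEMeasurable g volume := (hσ.pow_const _).coe_nnreal_real.indicator hJ
  -- The exponents satisfy `1/p' + 1/p = 1`, so the product of the two bumps is `σ` on `J ∩ Ioo b
  -- c`.
  have hpt : ∀ x, ‖f x‖ₑ * ‖(Ioo b c).indicator g x‖ₑ =
      (J ∩ Ioo b c).indicator (fun x => (σ x : ℝ≥0∞)) x := by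
    intro x
    by_cases hx : x ∈ Ioo b c
    · by_cases hxJ : x ∈ J
      · rw [hf, indicator_of_mem hx, indicator_of_mem hx, hg, indicator_of_mem hxJ,
          indicator_of_mem (s := J ∩ Ioo b c) ⟨hxJ, hx⟩, enorm_eq_nnnorm, enorm_eq_nnnorm,
          NNReal.nnnorm_eq, NNReal.nnnorm_eq, ← ENNReal.coe_mul,
          ← NNReal.rpow_add_of_nonneg]
        · rw [Real.conjExponent]
          have : 1 / (p / (p - 1)) + 1 / p = 1 := by
            have : p - 1 ≠ 0 := by linarith
            field_simp; ring
          rw [this, NNReal.rpow_one]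
        · rw [Real.conjExponent]
          have : 0 < p - 1 := by linarith
          positivity
        · positivity
      · rw [indicator_of_mem hx g, hg, indicator_of_notMem hxJ,
          indicator_of_notMem (s := J ∩ Ioo b c) (fun hx' => hxJ hx'.1)]
        simp
    · rw [hf, indicator_of_notMem hx, indicator_of_notMem (s := J ∩ Ioo b c) (fun hx' => hx hx'.2)]
      simp
  have hH := lintegral_mul_div_le_luxAvg_mul_luxAvg hac hΦ h hfm (hgm.indicator (measurableSet_Ioo (a := b) (b := c)))
  simp_rw [hpt] at hH
  rw [setLIntegral_indicator (hJ.inter measurableSet_Ioo), inter_assoc,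
    inter_eq_left.2 (Ioo_subset_Ioo_left (by linarith) : Ioo b c ⊆ Ioo a c),
    ← withDensity_apply _ (hJ.inter measurableSet_Ioo)] at hH
  change weightMeasure σ (J ∩ Ioo b c) / _ ≤ _ at hH
  have hB : weightMeasure w (Ioo a b) * luxAvg Φ f a c ^ p ≤
      bumpConst p w σ Φ * ENNReal.ofReal (c - a) := by
    rw [← ENNReal.div_le_iff (by simpa using hac) ENNReal.ofReal_ne_top,
      ENNReal.mul_div_right_comm]
    exact le_iSup_of_le a (le_iSup_of_le b (le_iSup_of_le c (le_iSup_of_le (by linarith)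
      (le_iSup_of_le hbc le_rfl))))
  calc _ ≤ weightMeasure w (Ioo a b) *
        (2 * κ * (luxAvg Φ f a c * luxAvg Ψ ((Ioo b c).indicator g) a c)) ^ p := by
        gcongr
    _ = (2 * κ) ^ p * (weightMeasure w (Ioo a b) * luxAvg Φ f a c ^ p) *
        luxAvg Ψ ((Ioo b c).indicator g) a c ^ p := by
        simp_rw [ENNReal.mul_rpow_of_nonneg _ _ hp0.le]
        ring
    _ ≤ _ := by gcongr

/-! ### Level sets of the maximal function on neighbouring intervals -/

section Level

variable {ν : Measure ℝ} {i : ℤ × ℤ} {x₀ : ℝ} {t : ℝ≥0∞}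

theorem measure_Ioo_le_of_maxMeas_le (h₀ : maxMeas ν x₀ ≤ t) {a b L : ℝ} (ha : x₀ ≤ a)
    (hb : b ≤ x₀ + L) (hL : 0 < L) : ν (Ioo a b) ≤ t * ENNReal.ofReal L :=
  (measure_mono (Ioo_subset_Ioo ha hb)).trans
    ((measure_Ioo_le_maxMeas ν x₀ hL).trans (by gcongr))

/-- To the right of a point where the maximal function is small, the maximal function is large
only on a small part of the neighbouring dyadic interval. -/
theorem two_mul_volume_dyadic_inter_le [IsFiniteMeasure ν] (ht0 : t ≠ 0) (htop : t ≠ ∞)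
    (hx₀ : x₀ ∈ dyadic i) (h₀ : maxMeas ν x₀ ≤ 2 * t) :
    2 * volume (dyadic (rightNeighbor i) ∩ {y | 128 * t < maxMeas ν y}) ≤
      ENNReal.ofReal (2 ^ i.1) := by
  set ℓ : ℝ := 2 ^ i.1 with hℓ
  have hℓ0 : 0 < ℓ := by positivity
  set E : Set ℝ := Ioo x₀ (x₀ + 3 * ℓ)
  -- Windows of length at most `ℓ` from `y` stay in `E`. A longer window of length `h` lies in `(x₀,
  -- x₀ + 3h)` and has mass at most `6th`, so only the mass in `E` can push the maximal function
  -- above `128t`. The weak type bound then gives measure at most `(48/128)ℓ < ℓ/2`.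
  have hsub : dyadic (rightNeighbor i) ∩ {y | 128 * t < maxMeas ν y} ⊆
      {y | 128 * t < maxMeas (ν.restrict E) y} := by
    rintro y ⟨hy, hy'⟩
    have hyx := dyadic_subset_Ioo hx₀ hy
    by_contra hcon
    refine absurd hy' (not_lt.2 (maxMeas_le fun h hh => ?_))
    rcases le_or_gt h ℓ with hle | hlt
    · have : ν (Ioo y (y + h)) = ν.restrict E (Ioo y (y + h)) := by
        rw [Measure.restrict_apply measurableSet_Ioo, inter_eq_left.2]
        exact Ioo_subset_Ioo hyx.1.le (by linarith [hyx.2])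
      rw [this]
      refine (measure_Ioo_le_maxMeas _ y hh).trans ?_
      gcongr
      exact not_lt.1 hcon
    · calc ν (Ioo y (y + h)) ≤ 2 * t * ENNReal.ofReal (3 * h) :=
            measure_Ioo_le_of_maxMeas_le h₀ hyx.1.le (by linarith [hyx.2]) (by linarith)
        _ = 6 * t * ENNReal.ofReal h := by
            rw [ENNReal.ofReal_mul (by norm_num)]; norm_num; ring
        _ ≤ 128 * t * ENNReal.ofReal h := by gcongr; norm_num
  have hE : (ν.restrict E) univ ≤ 6 * t * ENNReal.ofReal ℓ := by
    rw [Measure.restrict_apply_univ]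
    refine (measure_Ioo_le_of_maxMeas_le h₀ le_rfl le_rfl (by positivity)).trans_eq ?_
    rw [ENNReal.ofReal_mul (by norm_num)]; norm_num; ring
  have hw := volume_maxMeas_gt_le (ν.restrict E) (t := 128 * t) (mul_ne_zero (by norm_num) ht0)
    (ENNReal.mul_ne_top (by norm_num) htop)
  have hc0 : 48 * t ≠ 0 := mul_ne_zero (by norm_num) ht0
  have hc : 48 * t ≠ ∞ := ENNReal.mul_ne_top (by norm_num) htop
  rw [← ENNReal.mul_le_mul_iff_right hc0 hc]
  calc 48 * t * (2 * volume (dyadic (rightNeighbor i) ∩ {y | 128 * t < maxMeas ν y}))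
      ≤ 48 * t * (2 * volume {y | 128 * t < maxMeas (ν.restrict E) y}) := by gcongr
    _ = 96 * t * volume {y | 128 * t < maxMeas (ν.restrict E) y} := by ring
    _ ≤ 128 * t * volume {y | 128 * t < maxMeas (ν.restrict E) y} := by gcongr; norm_num
    _ ≤ 8 * (6 * t * ENNReal.ofReal ℓ) := hw.trans (by gcongr)
    _ = 48 * t * ENNReal.ofReal ℓ := by ring

/-- The block with `s = 2` starts where the right neighbour ends, so every `y` there sees the whole
block within distance `3·2^i.1`. This gives 12, rounded up to a power of two. -/
theorem lt_mul_maxMeas_of_mem_rightNeighbor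
    (hi : t * ENNReal.ofReal (2 ^ i.1) < 4 * ν (rightBlock 2 i)) {y : ℝ}
    (hy : y ∈ dyadic (rightNeighbor i)) : t < 16 * maxMeas ν y := by
  have hℓ0 : (0 : ℝ) < 2 ^ i.1 := by positivity
  have hsub : rightBlock 2 i ⊆ Ioo y (y + 3 * 2 ^ i.1) := by
    intro z hz
    simp only [dyadic, rightNeighbor, rightBlock, mem_Ico] at hy hz
    push_cast at hy hz
    constructor <;> linarith
  have h1 : t * ENNReal.ofReal (2 ^ i.1) < 12 * maxMeas ν y * ENNReal.ofReal (2 ^ i.1) := by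
    refine hi.trans_le ?_
    calc 4 * ν (rightBlock 2 i) ≤ 4 * (maxMeas ν y * ENNReal.ofReal (3 * 2 ^ i.1)) := by
          gcongr
          exact (measure_mono hsub).trans (measure_Ioo_le_maxMeas ν y (by positivity))
      _ = _ := by rw [ENNReal.ofReal_mul (by norm_num)]; norm_num; ring
  refine (lt_of_mul_lt_mul_right' h1).trans_le ?_
  gcongr
  norm_num

theorem le_two_mul_volume_dyadic_inter [IsFiniteMeasure ν] (ht0 : t ≠ 0) (htop : t ≠ ∞)
    (hx₀ : x₀ ∈ dyadic i) (h₀ : maxMeas ν x₀ ≤ 2 * t)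
    (hi : t * ENNReal.ofReal (2 ^ i.1) < 4 * ν (rightBlock 2 i)) :
    ENNReal.ofReal (2 ^ i.1) ≤ 2 * volume (dyadic (rightNeighbor i) ∩
      {y | t < 16 * maxMeas ν y ∧ maxMeas ν y ≤ 128 * t}) := by
  have h1 := two_mul_volume_dyadic_inter_le ht0 htop hx₀ h₀
  set D := dyadic (rightNeighbor i)
  set V := volume (D ∩ {y | t < 16 * maxMeas ν y ∧ maxMeas ν y ≤ 128 * t})
  set W := volume (D ∩ {y | 128 * t < maxMeas ν y})
  have h2 : ENNReal.ofReal (2 ^ i.1) ≤ V + W := by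
    have : volume D = ENNReal.ofReal (2 ^ i.1) := volume_dyadic (rightNeighbor i)
    rw [← this]
    refine (measure_mono fun y hy => ?_).trans (measure_union_le _ _)
    rcases le_or_gt (maxMeas ν y) (128 * t) with h | h
    · exact .inl ⟨hy, lt_mul_maxMeas_of_mem_rightNeighbor hi hy, h⟩
    · exact .inr ⟨hy, h⟩
  have h3 : ENNReal.ofReal (2 ^ i.1) + ENNReal.ofReal (2 ^ i.1) ≤
      2 * V + ENNReal.ofReal (2 ^ i.1) := by
    calc _ ≤ (V + W) + (V + W) := add_le_add h2 h2
      _ = 2 * V + 2 * W := by ring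
      _ ≤ _ := by gcongr
  exact (ENNReal.add_le_add_iff_right ENNReal.ofReal_ne_top).1 h3

end Level

/-! ### Local testing from the bump conditions -/

section Testing

variable {p : ℝ} {Φ Ψ : ℝ≥0 → ℝ≥0} {κ : ℝ≥0} {w σ : ℝ → ℝ≥0}

instance nullSingletonClass_weightMeasure (w : ℝ → ℝ≥0) :
    NullSingletonClass (weightMeasure w) :=
  ⟨fun x => withDensity_absolutelyContinuous _ _ (measure_singleton x)⟩

/-- Each selected interval, together with its left neighbour, covers part of the level set. Its
`ω`-mass is charged to the part of the selected interval where the maximal function is comparable to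
`t`; these parts are disjoint and lie in `Ioo α β`. -/
theorem weightMeasure_level_le (hp : 1 < p) (hΦ : IsYoung Φ) (hΨ : Ψ 0 = 0)
    (h : ∀ s t, s * t ≤ κ * (Φ s + Ψ t)) (hσ : IsWeight σ) (α β : ℝ) {t : ℝ≥0∞} (ht0 : t ≠ 0)
    (htop : t ≠ ∞) :
    let M := maxMeas ((weightMeasure σ).restrict (Ioo α β))
    t ^ p * weightMeasure w (Ioo α β ∩ {x | t < M x ∧ M x ≤ 2 * t}) ≤
      8 * (16 ^ p * (2 * κ) ^ p) * bumpConst p w σ Φ *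
      ∫⁻ y in Ioo α β ∩ {y | t < 16 * M y ∧ M y ≤ 128 * t},
        maxPlusYoung Ψ ((Ioo α β).indicator fun y => ((σ y ^ (1 / p) : ℝ≥0) : ℝ)) y ^ p := by
  intro M
  have hp0 : 0 < p := by linarith
  have hloc := hσ.isLocallyFiniteMeasure
  set J := Ioo α β with hJ
  set ν := (weightMeasure σ).restrict J with hν
  set ω := weightMeasure w
  set B := bumpConst p w σ Φ
  set g : ℝ → ℝ := J.indicator fun y => ((σ y ^ (1 / p) : ℝ≥0) : ℝ) with hg
  have hνfin : IsFiniteMeasure ν := ⟨by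
    rw [hν, Measure.restrict_apply_univ]
    exact (measure_mono Ioo_subset_Icc_self).trans_lt isCompact_Icc.measure_lt_top⟩
  have hMm : Measurable M := measurable_maxMeas ν
  set left : ℤ × ℤ → ℤ × ℤ := fun j => (j.1, j.2 - 1)
  have hright : ∀ j, rightNeighbor (left j) = j := fun j => by simp [rightNeighbor, left]
  -- Members are indexed by the interval between `left j` and its heavy block. The point `x₀`
  -- supplies the upper bound on `M` needed for the measure estimate, and it is retained for the
  -- maximal members.
  set Fam : Set (ℤ × ℤ) := {j | t * ENNReal.ofReal (2 ^ j.1) < 4 * ν (rightBlock 2 (left j)) ∧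
    ∃ x₀ ∈ J, x₀ ∈ dyadic (left j) ∧ M x₀ ≤ 2 * t} with hFam
  obtain ⟨K, hK⟩ := exists_forall_zpow_bound ht0 htop
    (ENNReal.mul_ne_top (by simp) (measure_ne_top ν univ) : 4 * ν univ ≠ ∞)
  obtain ⟨G, hGF, hGd, hG⟩ := exists_maximal_dyadic Fam K fun j hj =>
    hK _ (hj.1.le.trans (by gcongr; exact subset_univ _))
  set S : Set ℝ := {y | t < 16 * M y ∧ M y ≤ 128 * t} with hS
  have hSm : MeasurableSet S :=
    (measurableSet_lt measurable_const (hMm.const_mul _)).inter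
      (measurableSet_le hMm measurable_const)
  set U : ℤ × ℤ → Set ℝ := fun j => Ico ((j.2 - 1) * (2 : ℝ) ^ j.1) ((j.2 + 1) * 2 ^ j.1) with hU
  have hcov : J ∩ {x | t < M x ∧ M x ≤ 2 * t} ⊆ ⋃ j : G, U j := by
    rintro x ⟨hxJ, hxt, hx2⟩
    have hx' := lt_of_lt_of_le hxt (maxMeas_le_iSup_rightBlock ν (s := 2) (by norm_num) x)
    rw [mul_comm, ← ENNReal.div_lt_iff (.inl (by norm_num)) (.inl (by norm_num))] at hx'
    obtain ⟨i, hi⟩ := lt_iSup_iff.1 hx'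
    obtain ⟨hxi, hi⟩ := lt_iSup_iff.1 hi
    have hleft : left (rightNeighbor i) = i := by simp [rightNeighbor, left]
    have hiF : rightNeighbor i ∈ Fam := by
      refine ⟨?_, x, hxJ, by rwa [hleft], hx2⟩
      rw [hleft]
      have hne : ENNReal.ofReal ((2 : ℝ) ^ i.1) ≠ 0 := by simp; positivity
      rw [ENNReal.lt_div_iff_mul_lt (.inl hne) (.inl ENNReal.ofReal_ne_top)] at hi
      calc t * ENNReal.ofReal (2 ^ (rightNeighbor i).1)
          = 4 * (t / 4 * ENNReal.ofReal (2 ^ i.1)) := by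
            rw [← mul_assoc, ENNReal.mul_div_cancel (by norm_num) (by norm_num)]; rfl
        _ < _ := (ENNReal.mul_lt_mul_iff_right (by norm_num) (by norm_num)).2 hi
    obtain ⟨j, hj, hij⟩ := hG _ hiF
    refine mem_iUnion.2 ⟨⟨j, hj⟩, ?_⟩
    rw [← hright j] at hij
    have := dyadic_subset_union hij hxi
    simp only [U]
    simp only [left] at this
    push_cast at this
    convert this using 2
    ring
  have hone : ∀ j ∈ Fam, dyadic j ⊆ J ∧ t ^ p * ω (U j) ≤
      8 * (16 ^ p * (2 * κ) ^ p) * B * ∫⁻ y in dyadic j ∩ S, maxPlusYoung Ψ g y ^ p := by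
    rintro j ⟨hj1, x₀, hx₀J, hx₀, hx₀t⟩
    set ℓ : ℝ := 2 ^ j.1 with hℓ
    have hℓ0 : 0 < ℓ := by positivity
    have hx₀' : ((j.2 : ℝ) - 1) * ℓ ≤ x₀ ∧ x₀ < j.2 * ℓ := by
      have := hx₀
      simp only [dyadic, left, mem_Ico] at this
      push_cast at this
      simpa using this
    have hblock : rightBlock 2 (left j) = Ico ((j.2 + 1) * ℓ) ((j.2 + 3) * ℓ) := by
      simp only [rightBlock, left]
      push_cast
      rw [← hℓ]
      congr 1 <;> ring
    have hνblock : ν (rightBlock 2 (left j)) =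
        weightMeasure σ (J ∩ Ioo ((j.2 + 1) * ℓ) ((j.2 + 3) * ℓ)) := by
      rw [hblock, hν, Measure.restrict_apply measurableSet_Ico, inter_comm]
      exact measure_congr ((ae_eq_refl _).inter Ioo_ae_eq_Ico.symm)
    constructor
    -- The interval lies between `x₀ ∈ J` and a point of `J` in the block, which has positive
    -- `ν`-mass; hence it lies in `J`.
    · have hne : (J ∩ Ioo ((j.2 + 1) * ℓ) ((j.2 + 3) * ℓ)).Nonempty := by
        rw [nonempty_iff_ne_empty]
        intro hemp
        rw [hνblock, hemp] at hj1
        simp at hj1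
      obtain ⟨z, hzJ, hz, -⟩ := hne
      intro y hy
      simp only [dyadic, mem_Ico] at hy
      exact ⟨hx₀J.1.trans_le (hx₀'.2.le.trans hy.1), (hy.2.trans hz).trans hzJ.2⟩
    · set a : ℝ := (j.2 - 1) * ℓ with ha
      set b : ℝ := (j.2 + 1) * ℓ with hb
      set c : ℝ := (j.2 + 3) * ℓ with hc
      have hab : a < b := by rw [ha, hb]; nlinarith
      have hbc : b < c := by rw [hc, hb]; nlinarith
      have hca : c - a = 4 * ℓ := by rw [hc, ha]; ring
      set A := luxAvg Ψ ((Ioo b c).indicator g) a c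
      have hωU : ω (U j) = ω (Ioo a b) := measure_congr Ioo_ae_eq_Ico.symm
      have hmain := weightMeasure_mul_rpow_le hp hΦ h w hσ.aemeasurable
        (measurableSet_Ioo : MeasurableSet J) hab hbc
      rw [← hνblock, hca] at hmain
      have hℓE : ENNReal.ofReal ℓ ≠ 0 := by simpa using hℓ0
      have htle : t ≤ 16 * (ν (rightBlock 2 (left j)) / ENNReal.ofReal (4 * ℓ)) := by
        rw [ENNReal.ofReal_mul (by norm_num), ← mul_div_assoc, ENNReal.le_div_iff_mul_le
          (.inl (mul_ne_zero (by simp) hℓE))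
          (.inl (ENNReal.mul_ne_top (by simp) ENNReal.ofReal_ne_top))]
        calc t * (ENNReal.ofReal 4 * ENNReal.ofReal ℓ) = 4 * (t * ENNReal.ofReal ℓ) := by
              norm_num; ring
          _ ≤ 4 * (4 * ν (rightBlock 2 (left j))) := by gcongr
          _ = _ := by ring
      have hcore : t ^ p * ω (U j) ≤
          16 ^ p * ((2 * κ) ^ p * (B * ENNReal.ofReal (4 * ℓ)) * A ^ p) := by
        calc t ^ p * ω (U j)
            ≤ (16 * (ν (rightBlock 2 (left j)) / ENNReal.ofReal (4 * ℓ))) ^ p * ω (Ioo a b) := by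
              rw [hωU]; gcongr
          _ = 16 ^ p * (ω (Ioo a b) *
                (ν (rightBlock 2 (left j)) / ENNReal.ofReal (4 * ℓ)) ^ p) := by
              rw [ENNReal.mul_rpow_of_nonneg _ _ hp0.le]; ring
          _ ≤ _ := mul_le_mul_right hmain _
      have hvol : ENNReal.ofReal ℓ ≤ 2 * volume (dyadic j ∩ S) := by
        have := le_two_mul_volume_dyadic_inter (i := left j) ht0 htop hx₀ hx₀t hj1
        rwa [hright] at this
      -- Every `y` in `dyadic j` satisfies `a ≤ y < b`, so the Orlicz maximal function at `y`
      -- dominates the average `A`.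
      have hAint : A ^ p * volume (dyadic j ∩ S) ≤
          ∫⁻ y in dyadic j ∩ S, maxPlusYoung Ψ g y ^ p := by
        rw [← setLIntegral_const]
        refine setLIntegral_mono' ((measurableSet_dyadic j).inter hSm) fun y hy => ?_
        have hy1 := hy.1
        simp only [dyadic, mem_Ico] at hy1
        gcongr
        exact luxAvg_indicator_le_maxPlusYoung hΨ (by rw [ha]; nlinarith) hy1.2 hbc g
      calc t ^ p * ω (U j) ≤ 16 ^ p * ((2 * κ) ^ p * (B * ENNReal.ofReal (4 * ℓ)) * A ^ p) := hcore
        _ = 4 * (16 ^ p * (2 * κ) ^ p) * B * (A ^ p * ENNReal.ofReal ℓ) := by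
            rw [ENNReal.ofReal_mul (by norm_num)]; norm_num; ring
        _ ≤ 4 * (16 ^ p * (2 * κ) ^ p) * B * (A ^ p * (2 * volume (dyadic j ∩ S))) := by gcongr
        _ = 8 * (16 ^ p * (2 * κ) ^ p) * B * (A ^ p * volume (dyadic j ∩ S)) := by ring
        _ ≤ _ := by gcongr
  calc t ^ p * ω (J ∩ {x | t < M x ∧ M x ≤ 2 * t}) ≤ t ^ p * ∑' j : G, ω (U j) := by
        gcongr; exact (measure_mono hcov).trans (measure_iUnion_le _)
    _ = ∑' j : G, t ^ p * ω (U j) := ENNReal.tsum_mul_left.symm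
    _ ≤ ∑' j : G, 8 * (16 ^ p * (2 * κ) ^ p) * B *
          ∫⁻ y in dyadic j ∩ S, maxPlusYoung Ψ g y ^ p :=
        ENNReal.tsum_le_tsum fun j => (hone j (hGF j.2)).2
    _ = 8 * (16 ^ p * (2 * κ) ^ p) * B * ∫⁻ y in ⋃ j : G, dyadic j ∩ S, maxPlusYoung Ψ g y ^ p := by
        rw [ENNReal.tsum_mul_left, lintegral_iUnion fun j => (measurableSet_dyadic _).inter hSm]
        intro i j hij
        exact (hGd i.2 j.2 (fun h => hij (Subtype.ext h))).mono inter_subset_left inter_subset_left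
    _ ≤ _ := by
        gcongr
        exact iUnion_subset fun j => inter_subset_inter_left _ (hone j (hGF j.2)).1

theorem ENNReal.exists_mem_level {y : ℝ≥0∞} (h0 : y ≠ 0) (htop : y ≠ ∞) :
    ∃ n : ℤ, (2 : ℝ≥0∞) ^ n < y ∧ y ≤ 2 * 2 ^ n := by
  obtain ⟨n, hn1, hn2⟩ := ENNReal.exists_mem_Ioc_zpow h0 htop (by norm_num : (1 : ℝ≥0∞) < 2)
    (by norm_num)
  refine ⟨n, hn1, hn2.trans_eq ?_⟩
  rw [ENNReal.zpow_add (by norm_num) (by norm_num), zpow_one, mul_comm]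

/-- The local testing condition follows from the bump conditions. -/
theorem setLIntegral_maxMeas_restrict_le (hp : 1 < p) (hΦ : IsYoung Φ) (hΨ : Ψ 0 = 0)
    (h : ∀ s t, s * t ≤ κ * (Φ s + Ψ t)) (hσ : IsWeight σ) (α β : ℝ) :
    ∫⁻ x in Ioo α β, maxMeas ((weightMeasure σ).restrict (Ioo α β)) x ^ p ∂weightMeasure w ≤
      11 * (2 ^ p * (8 * (16 ^ p * (2 * κ) ^ p))) * bumpConst p w σ Φ *
      ∫⁻ y in Ioo α β,
        maxPlusYoung Ψ ((Ioo α β).indicator fun y => ((σ y ^ (1 / p) : ℝ≥0) : ℝ)) y ^ p := by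
  have hp0 : 0 < p := by linarith
  have hloc := hσ.isLocallyFiniteMeasure
  have hz0 : ∀ n : ℤ, (2 : ℝ≥0∞) ^ n ≠ 0 := fun n =>
    (ENNReal.zpow_pos (by norm_num) (by norm_num) _).ne'
  have hzt : ∀ n : ℤ, (2 : ℝ≥0∞) ^ n ≠ ∞ := fun n =>
    (ENNReal.zpow_lt_top (by norm_num) (by norm_num) _).ne
  set J := Ioo α β with hJ
  set ν := (weightMeasure σ).restrict J with hν
  set M := maxMeas ν with hM
  set ω := weightMeasure w
  set B := bumpConst p w σ Φ
  set g : ℝ → ℝ := J.indicator fun y => ((σ y ^ (1 / p) : ℝ≥0) : ℝ) with hg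
  have hνfin : IsFiniteMeasure ν := ⟨by
    rw [hν, Measure.restrict_apply_univ]
    exact (measure_mono Ioo_subset_Icc_self).trans_lt isCompact_Icc.measure_lt_top⟩
  have hMm : Measurable M := measurable_maxMeas ν
  -- The level sets below miss the points where `M = ∞`. The weak type bound makes them Lebesgue
  -- null, hence `ω`-null.
  have hMtop : ∀ᵐ x ∂ω, M x ≠ ∞ := by
    have hvol : volume {x | M x = ∞} = 0 := by
      by_contra hne
      have h1 : ∀ n : ℕ, n * volume {x | M x = ∞} ≤ 8 * ν univ := by
        intro n
        rcases Nat.eq_zero_or_pos n with rfl | hn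
        · simp
        refine le_trans ?_ (volume_maxMeas_gt_le ν (t := n) (by exact_mod_cast hn.ne') (by simp))
        gcongr with x
        intro hx
        change (n : ℝ≥0∞) < M x
        rw [show M x = ∞ from hx]
        simp
      have hfin : 8 * ν univ / volume {x | M x = ∞} ≠ ∞ :=
        ENNReal.div_ne_top (ENNReal.mul_ne_top (by simp) (measure_ne_top _ _)) hne
      obtain ⟨n, hn⟩ := ENNReal.exists_nat_gt hfin
      refine absurd (h1 n) (not_le.2 ?_)
      rcases eq_or_ne (volume {x | M x = ∞}) ∞ with ht | ht
      · have := h1 1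
        rw [ht] at this
        simp at this
        exact absurd this (ENNReal.mul_ne_top (by simp) (measure_ne_top _ _))
      · rwa [ENNReal.div_lt_iff (.inl hne) (.inl ht)] at hn
    rw [ae_iff]
    simp only [ne_eq, not_not]
    exact withDensity_absolutelyContinuous _ _ hvol
  set L : ℤ → Set ℝ := fun n => {x | (2 : ℝ≥0∞) ^ n < M x ∧ M x ≤ 2 * 2 ^ n} with hL
  have hLm : ∀ n, MeasurableSet (L n) := fun n =>
    (measurableSet_lt measurable_const hMm).inter (measurableSet_le hMm measurable_const)
  have hLdisj : Pairwise fun m n => Disjoint (J ∩ L m) (J ∩ L n) := by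
    have key : ∀ m n x, x ∈ L m → x ∈ L n → m ≤ n := by
      intro m n x hm hn
      by_contra hcon
      have h2 := ENNReal.zpow_le_of_le (by norm_num : (1 : ℝ≥0∞) ≤ 2) (by omega : n + 1 ≤ m)
      rw [ENNReal.zpow_add (by norm_num) (by norm_num), zpow_one, mul_comm] at h2
      exact absurd (hm.1.trans_le hn.2) (not_lt.2 h2)
    intro m n hmn
    exact Set.disjoint_left.2 fun x hx hx' =>
      hmn (le_antisymm (key m n x hx.2 hx'.2) (key n m x hx'.2 hx.2))
  -- If `2^m < M ≤ 2^(m+1)`, the two inequalities force `n - 4 ≤ m ≤ n + 6`, which is eleven levels.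
  have hS : ∀ n : ℤ, J ∩ {y | (2 : ℝ≥0∞) ^ n < 16 * M y ∧ M y ≤ 128 * 2 ^ n} ⊆
      ⋃ j : Fin 11, J ∩ L (n + ((j : ℕ) - 4 : ℤ)) := by
    rintro n x ⟨hxJ, hx1, hx2⟩
    have hMx0 : M x ≠ 0 := fun h0 => by simp [h0] at hx1
    have hMxt : M x ≠ ∞ := fun h0 => by
      rw [h0] at hx2
      exact ENNReal.mul_ne_top (by norm_num) (hzt n) (top_le_iff.1 hx2)
    obtain ⟨m, hm1, hm2⟩ := ENNReal.exists_mem_level hMx0 hMxt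
    have hlt : ∀ a b : ℤ, (2 : ℝ≥0∞) ^ a < 2 ^ b → a < b := fun a b hab => by
      by_contra hcon
      exact absurd (ENNReal.zpow_le_of_le (by norm_num : (1 : ℝ≥0∞) ≤ 2) (not_lt.1 hcon))
        (not_le.2 hab)
    have hpow : ∀ (k : ℕ) (a : ℤ), (2 : ℝ≥0∞) ^ k * 2 ^ a = 2 ^ (a + k) := fun k a => by
      rw [ENNReal.zpow_add (by norm_num) (by norm_num), zpow_natCast, mul_comm]
    have h1 : m < n + 7 := by
      refine hlt _ _ (hm1.trans_le (hx2.trans_eq ?_))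
      have := hpow 7 n
      norm_num at this
      exact this
    have h2 : n < m + 5 := by
      refine hlt _ _ (hx1.trans_le ?_)
      have := hpow 5 m
      norm_num at this
      rw [← this]
      calc 16 * M x ≤ 16 * (2 * 2 ^ m) := by gcongr
        _ = _ := by ring
    refine mem_iUnion.2 ⟨⟨(m - n + 4).toNat, by omega⟩, hxJ, ?_⟩
    have : n + (((m - n + 4).toNat : ℕ) - 4 : ℤ) = m := by omega
    simp only [this]
    exact ⟨hm1, hm2⟩
  set I : ℤ → ℝ≥0∞ := fun n => ∫⁻ y in J ∩ L n, maxPlusYoung Ψ g y ^ p with hI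
  set Q : ℝ≥0∞ := 8 * (16 ^ p * (2 * κ) ^ p) with hQ
  calc ∫⁻ x in J, M x ^ p ∂ω
      ≤ ∫⁻ x in J, ∑' n : ℤ, (J ∩ L n).indicator (fun _ => (2 * (2 : ℝ≥0∞) ^ n) ^ p) x ∂ω := by
        refine setLIntegral_mono_ae (Measurable.tsum fun n =>
          measurable_const.indicator (measurableSet_Ioo.inter (hLm n))).aemeasurable ?_
        filter_upwards [hMtop] with x hxt hxJ
        rcases eq_or_ne (M x) 0 with h0 | h0
        · rw [h0, ENNReal.zero_rpow_of_pos hp0]; exact zero_le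
        obtain ⟨n, hn1, hn2⟩ := ENNReal.exists_mem_level h0 hxt
        refine le_trans ?_ (ENNReal.le_tsum n)
        rw [indicator_of_mem (s := J ∩ L n) ⟨hxJ, hn1, hn2⟩]
        gcongr
    _ ≤ ∫⁻ x, ∑' n : ℤ, (J ∩ L n).indicator (fun _ => (2 * (2 : ℝ≥0∞) ^ n) ^ p) x ∂ω :=
        setLIntegral_le_lintegral _ _
    _ = ∑' n : ℤ, 2 ^ p * (((2 : ℝ≥0∞) ^ n) ^ p * ω (J ∩ L n)) := by
        rw [lintegral_tsum fun n =>
          (measurable_const.indicator (measurableSet_Ioo.inter (hLm n))).aemeasurable]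
        congr 1 with n
        rw [lintegral_indicator_const (measurableSet_Ioo.inter (hLm n)),
          ENNReal.mul_rpow_of_nonneg _ _ hp0.le, mul_assoc]
    _ ≤ ∑' n : ℤ, 2 ^ p * (Q * B * ∑' j : Fin 11, I (n + ((j : ℕ) - 4 : ℤ))) := by
        refine ENNReal.tsum_le_tsum fun n => mul_le_mul_right ?_ _
        refine (weightMeasure_level_le hp hΦ hΨ h hσ α β (hz0 n) (hzt n)).trans ?_
        refine mul_le_mul_right ?_ _
        exact (lintegral_mono_set (hS n)).trans (lintegral_iUnion_le _ _)
    _ = 2 ^ p * (Q * B * ∑' j : Fin 11, ∑' n : ℤ, I (n + ((j : ℕ) - 4 : ℤ))) := by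
        rw [ENNReal.tsum_mul_left, ENNReal.tsum_mul_left, ENNReal.tsum_comm]
    _ = 2 ^ p * (Q * B * (11 * ∑' n : ℤ, I n)) := by
        congr 2
        have : ∀ j : Fin 11, ∑' n : ℤ, I (n + ((j : ℕ) - 4 : ℤ)) = ∑' n : ℤ, I n := fun j =>
          (Equiv.addRight ((j : ℕ) - 4 : ℤ)).tsum_eq I
        simp_rw [this]
        rw [tsum_fintype, Finset.sum_const, Finset.card_univ, Fintype.card_fin, nsmul_eq_mul]
        norm_num
    _ ≤ 2 ^ p * (Q * B * (11 * ∫⁻ y in J, maxPlusYoung Ψ g y ^ p)) := by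
        gcongr
        rw [hI, ← lintegral_iUnion (fun n => measurableSet_Ioo.inter (hLm n)) hLdisj]
        exact lintegral_mono_set (iUnion_subset fun n => inter_subset_left)
    _ = _ := by ring

end Testing

/-! ### The two-weight theorem -/

/-- The two-weight bump theorem for the one-sided maximal function. -/
theorem exists_eLpNorm_maxPlus_mul_le {p : ℝ} (hp : 1 < p) (κ : ℝ≥0) :
    ∃ C : ℝ≥0, ∀ Φ Ψ : ℝ≥0 → ℝ≥0, IsYoung Φ → IsYoung Ψ →
      (∀ t : ℝ≥0, 0 < t → youngInv Φ t * youngInv Ψ t ≤ (κ : ℝ≥0∞) * (t : ℝ≥0∞)) →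
      ∀ w σ : ℝ → ℝ≥0, IsWeight σ →
      ∀ f : ℝ → ℝ, AEStronglyMeasurable f (weightMeasure σ) →
        eLpNorm (maxPlus fun x => f x * (σ x : ℝ)) (ENNReal.ofReal p) (weightMeasure w) ≤
          (C : ℝ≥0∞) * (wMinusConst p σ Ψ * bumpConst p w σ Φ) ^ (1 / p) *
            eLpNorm f (ENNReal.ofReal p) (weightMeasure σ) := by
  have hp0 : 0 < p := by linarith
  obtain ⟨C₁, hC₁, hemb⟩ := exists_lintegral_maxMeas_withDensity_le hp
  obtain ⟨C₂, hC₂, hglob⟩ := exists_lintegral_maxMeas_restrict_le hp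
  set Q : ℝ≥0∞ := 11 * (2 ^ p * (8 * (16 ^ p * (2 * κ) ^ p))) with hQ
  have hQt : Q ≠ ∞ := by
    have : ∀ c : ℝ≥0∞, c ≠ ∞ → c ^ p ≠ ∞ := fun c hc => ENNReal.rpow_ne_top_of_nonneg hp0.le hc
    refine ENNReal.mul_ne_top (by norm_num) (ENNReal.mul_ne_top (this _ (by norm_num))
      (ENNReal.mul_ne_top (by norm_num) (ENNReal.mul_ne_top (this _ (by norm_num))
      (this _ (ENNReal.mul_ne_top (by norm_num) ENNReal.coe_ne_top)))))
  have hCt : (C₁ * C₂ * Q) ^ (1 / p) ≠ ∞ := ENNReal.rpow_ne_top_of_nonneg (by positivity)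
    (ENNReal.mul_ne_top (ENNReal.mul_ne_top hC₁ hC₂) hQt)
  refine ⟨((C₁ * C₂ * Q) ^ (1 / p)).toNNReal, fun Φ Ψ hΦ hΨ hinv w σ hσ f hf => ?_⟩
  rw [ENNReal.coe_toNNReal hCt]
  have hloc := hσ.isLocallyFiniteMeasure
  set μ := weightMeasure σ with hμ
  set ω := weightMeasure w
  set W := wMinusConst p σ Ψ
  set B := bumpConst p w σ Φ
  have hfin : ∀ a b, μ (Ioo a b) ≠ ∞ := fun a b =>
    ((measure_mono Ioo_subset_Icc_self).trans_lt isCompact_Icc.measure_lt_top).ne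
  have hlocal : ∀ a b, a < b → ∫⁻ x in Ioo a b, maxMeas (μ.restrict (Ioo a b)) x ^ p ∂ω ≤
      Q * B * W * μ (Ioo a b) := by
    intro a b hab
    rcases eq_or_ne (μ (Ioo a b)) 0 with h0 | h0
    · rw [Measure.restrict_eq_zero.2 h0]
      simp [maxMeas_zero, hp0]
    refine (setLIntegral_maxMeas_restrict_le hp hΦ hΨ.map_zero (young_mul_le hΦ hΨ hinv) hσ a b).trans ?_
    rw [mul_assoc (Q * B)]
    refine mul_le_mul_right ?_ _
    rw [← ENNReal.div_le_iff h0 (hfin a b)]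
    exact le_iSup_of_le a (le_iSup_of_le b (le_iSup_of_le hab le_rfl))
  have hdy : ∀ i, ∫⁻ x, maxMeas (μ.restrict (dyadic i)) x ^ p ∂ω ≤
      C₂ * (Q * B * W) * μ (dyadic i) := by
    intro i
    -- Testing is stated on open intervals and the embedding on half-open ones; `μ` has no atoms.
    have hae : dyadic i =ᵐ[μ] Ioo (i.2 * (2 : ℝ) ^ i.1) ((i.2 + 1) * 2 ^ i.1) :=
      Ioo_ae_eq_Ico.symm
    rw [Measure.restrict_congr_set hae, measure_congr hae]
    refine hglob μ ω _ hlocal _ _ ?_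
    have : (0 : ℝ) < 2 ^ i.1 := by positivity
    nlinarith
  obtain ⟨f', hf', hff'⟩ := hf
  have hfm : Measurable fun x => ‖f' x‖ₑ := hf'.measurable.enorm
  have hmax : maxPlus (fun x => f x * (σ x : ℝ)) =
      maxMeas (μ.withDensity fun x => ‖f' x‖ₑ) := by
    rw [maxPlus_eq_maxMeas, hμ, weightMeasure,
      ← withDensity_mul₀ hσ.aemeasurable.coe_nnreal_ennreal hfm.aemeasurable]
    congr 1
    refine withDensity_congr_ae ?_
    have h1 := (ae_withDensity_iff' hσ.aemeasurable.coe_nnreal_ennreal).1 hff'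
    filter_upwards [h1] with x hx
    simp only [Pi.mul_apply]
    -- The representative `f'` agrees with `f` only `μ`-almost everywhere, so nothing is known where
    -- `σ` vanishes; there both densities are 0.
    by_cases h0 : σ x = 0
    · simp [h0]
    · rw [← hx (by simpa using h0), enorm_mul, mul_comm]
      congr 1
      simp [enorm_eq_nnnorm]
  have hnorm : ∫⁻ x, ‖f' x‖ₑ ^ p ∂μ = ∫⁻ x, ‖f x‖ₑ ^ p ∂μ := by
    refine lintegral_congr_ae ?_
    filter_upwards [hff'] with x hx
    rw [hx]
  have hmain := hemb μ ω _ hdy _ hfm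
  rw [← hmax, hnorm] at hmain
  have hpe : ENNReal.ofReal p ≠ 0 := by simpa using hp0
  rw [eLpNorm_eq_lintegral_rpow_enorm_toReal hpe ENNReal.ofReal_ne_top,
    eLpNorm_eq_lintegral_rpow_enorm_toReal hpe ENNReal.ofReal_ne_top, ENNReal.toReal_ofReal hp0.le,
    ← ENNReal.mul_rpow_of_nonneg _ _ (by positivity : (0 : ℝ) ≤ 1 / p),
    ← ENNReal.mul_rpow_of_nonneg _ _ (by positivity : (0 : ℝ) ≤ 1 / p)]
  refine ENNReal.rpow_le_rpow ?_ (by positivity)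
  simp only [enorm_eq_self]
  exact hmain.trans_eq (by ring)

/-! ### Power functions and the dual weight -/

section Power

variable {q : ℝ}

theorem isYoung_rpow (hq : 1 ≤ q) : IsYoung fun t => t ^ q where
  continuous := NNReal.continuous_rpow_const (by linarith)
  convex := by
    refine ⟨convex_univ, fun x _ y _ a b _ _ hab => ?_⟩
    have h := (convexOn_rpow hq).2 x.coe_nonneg y.coe_nonneg a.coe_nonneg b.coe_nonneg
      (by exact_mod_cast hab)
    simp only [smul_eq_mul] at h ⊢
    exact_mod_cast h
  map_zero := NNReal.zero_rpow (by linarith)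

theorem youngInv_rpow_le (hq : 0 < q) (t : ℝ≥0) :
    youngInv (fun t => t ^ q) t ≤ (t ^ (1 / q) : ℝ≥0) := by
  by_contra! hcon
  obtain ⟨s, hs1, hs2⟩ := ENNReal.lt_iff_exists_nnreal_btwn.1 hcon
  refine absurd hs2 (not_lt.2 (iInf₂_le s ?_))
  rw [ENNReal.coe_lt_coe] at hs1
  calc t = (t ^ (1 / q)) ^ q := by rw [← NNReal.rpow_mul, one_div_mul_cancel hq.ne', NNReal.rpow_one]
    _ < s ^ q := NNReal.rpow_lt_rpow hs1 hq

theorem luxAvg_rpow_le (hq : 0 < q) (f : ℝ → ℝ) (a b : ℝ) :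
    luxAvg (fun t => t ^ q) f a b ^ q ≤
      (∫⁻ x in Ioo a b, ‖f x‖ₑ ^ q) / ENNReal.ofReal (b - a) := by
  set Y := (∫⁻ x in Ioo a b, ‖f x‖ₑ ^ q) / ENNReal.ofReal (b - a) with hY
  rw [← ENNReal.le_rpow_inv_iff hq]
  by_contra! hcon
  obtain ⟨r, hr1, hr2⟩ := ENNReal.lt_iff_exists_nnreal_btwn.1 hcon
  have hr0 : 0 < r := by exact_mod_cast lt_of_le_of_lt zero_le hr1
  have hrq0 : ((r : ℝ≥0∞) ^ q) ≠ 0 := by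
    simp [ENNReal.rpow_eq_zero_iff, hr0.ne']
  have hrqt : ((r : ℝ≥0∞) ^ q) ≠ ∞ := ENNReal.rpow_ne_top_of_nonneg hq.le ENNReal.coe_ne_top
  refine absurd hr2 (not_lt.2 (iInf_le_of_le r (iInf_le_of_le hr0 (iInf_le_of_le ?_ le_rfl))))
  have hpt : ∀ x, (((‖f x‖₊ / r) ^ q : ℝ≥0) : ℝ≥0∞) = ((r : ℝ≥0∞) ^ q)⁻¹ * ‖f x‖ₑ ^ q := by
    intro x
    rw [ENNReal.coe_rpow_of_nonneg _ hq.le, ENNReal.coe_div hr0.ne',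
      ENNReal.div_rpow_of_nonneg _ _ hq.le, enorm_eq_nnnorm, div_eq_mul_inv, mul_comm]
  simp_rw [hpt]
  rw [lintegral_const_mul' _ _ (ENNReal.inv_ne_top.2 hrq0), mul_div_assoc, ← hY, mul_comm,
    ← div_eq_mul_inv, ENNReal.div_le_iff hrq0 hrqt, one_mul, ← ENNReal.rpow_inv_le_iff hq]
  exact hr1.le

end Power

section DualWeight

variable {p : ℝ} {w : ℝ → ℝ≥0}

theorem enorm_indicator_rpow_inv {q : ℝ} (hq : 0 < q) (σ : ℝ → ℝ≥0) (J : Set ℝ) (x : ℝ) :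
    ‖J.indicator (fun y => ((σ y ^ (1 / q) : ℝ≥0) : ℝ)) x‖ₑ ^ q =
      J.indicator (fun y => (σ y : ℝ≥0∞)) x := by
  by_cases hx : x ∈ J
  · rw [indicator_of_mem hx, indicator_of_mem hx, enorm_eq_nnnorm, NNReal.nnnorm_eq,
      ← ENNReal.coe_rpow_of_nonneg _ hq.le, ← NNReal.rpow_mul, one_div_mul_cancel hq.ne',
      NNReal.rpow_one]
  · rw [indicator_of_notMem hx, indicator_of_notMem hx, enorm_zero, ENNReal.zero_rpow_of_pos hq]

/-- For `Ψ = t^p` the `p`-th power of the Luxemburg average of `σ^{1/p}` is at most the plain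
average of `σ`, so the Orlicz maximal function reduces to `M⁺`. -/
theorem wMinusConst_rpow_le (hp : 0 < p) (σ : ℝ → ℝ≥0) :
    wMinusConst p σ (fun t => t ^ p) ≤ aInftyMinusConst σ := by
  refine iSup_mono fun a => iSup_mono fun b => iSup_mono fun _ => ?_
  refine ENNReal.div_le_div_right (lintegral_mono fun x => ?_) _
  simp only
  rw [← ENNReal.le_rpow_inv_iff hp]
  refine iSup₂_le fun h hh => ?_
  rw [ENNReal.le_rpow_inv_iff hp]
  refine (luxAvg_rpow_le hp _ _ _).trans ?_
  refine le_trans (le_of_eq ?_) (le_iSup₂ (f := fun (h : ℝ) (_ : 0 < h) => (∫⁻ y in Ioo x (x + h),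
    ‖(Ioo a b).indicator (fun y => (σ y : ℝ)) y‖ₑ) / ENNReal.ofReal h) h hh)
  simp_rw [enorm_indicator_rpow_inv hp]
  rw [add_sub_cancel_left]
  congr 2 with y
  by_cases hy : y ∈ Ioo a b
  · rw [indicator_of_mem hy, indicator_of_mem hy]; simp [enorm_eq_nnnorm]
  · rw [indicator_of_notMem hy, indicator_of_notMem hy]; simp

/-- Since `p = p'(p - 1)`, the `p`-th power of the Luxemburg average is the `(p - 1)`-th power of a
quantity bounded by the average of the dual weight. -/
theorem bumpConst_rpow_le (hp : 1 < p) (w : ℝ → ℝ≥0) :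
    bumpConst p w (dualWeight p w) (fun t => t ^ p.conjExponent) ≤ apPlusConst p w := by
  have hp1 : 0 < p - 1 := by linarith
  have hp' : 0 < p.conjExponent := by rw [Real.conjExponent]; positivity
  refine iSup_mono fun a => iSup_mono fun b => iSup_mono fun c => iSup_mono fun hab =>
    iSup_mono fun hbc => ?_
  gcongr
  set g := (Ioo b c).indicator fun y => ((dualWeight p w y ^ (1 / p.conjExponent) : ℝ≥0) : ℝ)
  have h1 : luxAvg (fun t => t ^ p.conjExponent) g a c ^ p =
      (luxAvg (fun t => t ^ p.conjExponent) g a c ^ p.conjExponent) ^ (p - 1) := by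
    rw [← ENNReal.rpow_mul, Real.conjExponent, div_mul_cancel₀ _ hp1.ne']
  rw [h1]
  refine ENNReal.rpow_le_rpow ((luxAvg_rpow_le hp' _ _ _).trans ?_) hp1.le
  refine ENNReal.div_le_div_right ?_ _
  simp_rw [g, enorm_indicator_rpow_inv hp']
  rw [setLIntegral_indicator measurableSet_Ioo, weightMeasure,
    withDensity_apply _ measurableSet_Ioo]
  exact lintegral_mono_set inter_subset_left

/-- The interval `(x-2, x-1)` has positive `w`-mass, so a finite one-sided constant forces the dual
weight to have finite mass on `(x-1, x+1)`. -/
theorem isWeight_dualWeight (hp : 1 < p) (hw : IsWeight w) (hpos : ∀ᵐ x : ℝ, 0 < w x)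
    (hA : apPlusConst p w < ∞) : IsWeight (dualWeight p w) := by
  have hp1 : 0 < p - 1 := by linarith
  have hm : AEMeasurable (dualWeight p w) volume := hw.aemeasurable.pow_const _
  intro x
  refine ⟨Ioo (x - 1) (x + 1), Ioo_mem_nhds (by linarith) (by linarith),
    hm.coe_nnreal_real.aestronglyMeasurable.restrict, ?_⟩
  have hw0 : weightMeasure w (Ioo (x - 2) (x - 1)) ≠ 0 := by
    intro h0
    have hac : volume ≪ weightMeasure w :=
      withDensity_absolutelyContinuous' hw.aemeasurable.coe_nnreal_ennreal
        (by filter_upwards [hpos] with y hy; simpa using hy.ne')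
    have := hac h0
    rw [Real.volume_Ioo] at this
    norm_num at this
  have hle : weightMeasure w (Ioo (x - 2) (x - 1)) / ENNReal.ofReal (x + 1 - (x - 2)) *
      (weightMeasure (dualWeight p w) (Ioo (x - 1) (x + 1)) /
        ENNReal.ofReal (x + 1 - (x - 2))) ^ (p - 1) ≤ apPlusConst p w :=
    le_iSup_of_le (x - 2) (le_iSup_of_le (x - 1) (le_iSup_of_le (x + 1)
      (le_iSup_of_le (by linarith) (le_iSup_of_le (by linarith) le_rfl))))
  have hfin : weightMeasure (dualWeight p w) (Ioo (x - 1) (x + 1)) ≠ ∞ := by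
    intro htop
    rw [htop, ENNReal.top_div_of_ne_top ENNReal.ofReal_ne_top, ENNReal.top_rpow_of_pos hp1,
      ENNReal.mul_top (ENNReal.div_ne_zero.2 ⟨hw0, ENNReal.ofReal_ne_top⟩)] at hle
    exact absurd hA (not_lt.2 hle)
  rw [weightMeasure, withDensity_apply _ measurableSet_Ioo] at hfin
  rw [HasFiniteIntegral]
  simpa [enorm_eq_nnnorm, lt_top_iff_ne_top] using hfin

/-- The substitution `f = gσ` is isometric because `σ^{1-p} = w`. -/
theorem lintegral_div_dualWeight (hp : 1 < p) (hw : IsWeight w) (hpos : ∀ᵐ x : ℝ, 0 < w x)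
    {f : ℝ → ℝ} (hf : AEMeasurable f volume) :
    ∫⁻ x, ‖f x / (dualWeight p w x : ℝ)‖ₑ ^ p ∂weightMeasure (dualWeight p w) =
      ∫⁻ x, ‖f x‖ₑ ^ p ∂weightMeasure w := by
  have hp0 : 0 < p := by linarith
  have hm : AEMeasurable (dualWeight p w) volume := hw.aemeasurable.pow_const _
  have hdm : AEMeasurable (fun x => ‖f x / (dualWeight p w x : ℝ)‖ₑ ^ p) volume :=
    (hf.div hm.coe_nnreal_real).enorm.pow_const _
  rw [weightMeasure, weightMeasure,
    lintegral_withDensity_eq_lintegral_mul₀ hm.coe_nnreal_ennreal hdm,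
    lintegral_withDensity_eq_lintegral_mul₀ hw.aemeasurable.coe_nnreal_ennreal
      (hf.enorm.pow_const _)]
  refine lintegral_congr_ae ?_
  filter_upwards [hpos] with x hx
  simp only [Pi.mul_apply, enorm_eq_nnnorm, nnnorm_div, NNReal.nnnorm_eq]
  rw [← ENNReal.coe_rpow_of_nonneg _ hp0.le, ← ENNReal.coe_rpow_of_nonneg _ hp0.le,
    ← ENNReal.coe_mul, ← ENNReal.coe_mul, ENNReal.coe_inj, NNReal.div_rpow, div_eq_mul_inv,
    mul_left_comm, mul_comm]
  congr 1
  rw [dualWeight, ← NNReal.rpow_mul, ← NNReal.rpow_neg, ← NNReal.rpow_add hx.ne']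
  have : p - 1 ≠ 0 := by linarith
  rw [show -(1 / (p - 1)) + -(-(1 / (p - 1)) * p) = 1 by field_simp; ring, NNReal.rpow_one]

end DualWeight

/-! ### The main theorem -/

theorem theorem4 (p : ℝ) (hp : 1 < p) :
    (∀ κ : ℝ≥0, ∃ C : ℝ≥0, ∀ Φ Ψ : ℝ≥0 → ℝ≥0, IsYoung Φ → IsYoung Ψ →
      (∀ t : ℝ≥0, 0 < t → youngInv Φ t * youngInv Ψ t ≤ (κ : ℝ≥0∞) * (t : ℝ≥0∞)) →
      ∀ w σ : ℝ → ℝ≥0, IsWeight w → IsWeight σ →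
      ∀ f : ℝ → ℝ, AEStronglyMeasurable f (weightMeasure σ) →
        eLpNorm (maxPlus fun x => f x * (σ x : ℝ)) (ENNReal.ofReal p) (weightMeasure w) ≤
          (C : ℝ≥0∞) * (wMinusConst p σ Ψ * bumpConst p w σ Φ) ^ (1 / p) *
            eLpNorm f (ENNReal.ofReal p) (weightMeasure σ)) ∧
    (∃ C : ℝ≥0, ∀ w : ℝ → ℝ≥0, IsWeight w → (∀ᵐ x : ℝ, 0 < w x) → apPlusConst p w < ∞ →
      ∀ f : ℝ → ℝ, AEStronglyMeasurable f (weightMeasure w) →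
        eLpNorm (maxPlus f) (ENNReal.ofReal p) (weightMeasure w) ≤
          (C : ℝ≥0∞) * (apPlusConst p w * aInftyMinusConst (dualWeight p w)) ^ (1 / p) *
            eLpNorm f (ENNReal.ofReal p) (weightMeasure w)) := by
  have hp0 : 0 < p := by linarith
  have hp1 : 0 < p - 1 := by linarith
  constructor
  · intro κ
    obtain ⟨C, hC⟩ := exists_eLpNorm_maxPlus_mul_le hp κ
    exact ⟨C, fun Φ Ψ hΦ hΨ h w σ _ hσ f hf => hC Φ Ψ hΦ hΨ h w σ hσ f hf⟩
  · obtain ⟨C, hC⟩ := exists_eLpNorm_maxPlus_mul_le hp 1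
    refine ⟨C, fun w hw hpos hA f hf => ?_⟩
    have hp' : 1 ≤ p.conjExponent := by
      rw [Real.conjExponent, one_le_div hp1]; linarith
    -- The powers `t^{p'}` and `t^p` have inverses bounded by `t^{1/p'}` and `t^{1/p}`, whose
    -- product is `t`; hence `κ = 1`.
    have hinv : ∀ t : ℝ≥0, 0 < t → youngInv (fun t => t ^ p.conjExponent) t *
        youngInv (fun t => t ^ p) t ≤ ((1 : ℝ≥0) : ℝ≥0∞) * (t : ℝ≥0∞) := by
      intro t ht
      refine (mul_le_mul' (youngInv_rpow_le (by linarith) t) (youngInv_rpow_le hp0 t)).trans_eq ?_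
      rw [← ENNReal.coe_mul, ← NNReal.rpow_add ht.ne', Real.conjExponent,
        show 1 / (p / (p - 1)) + 1 / p = 1 by field_simp; ring, NNReal.rpow_one, ENNReal.coe_one,
        one_mul]
    have hσ := isWeight_dualWeight hp hw hpos hA
    have hac : volume ≪ weightMeasure w :=
      withDensity_absolutelyContinuous' hw.aemeasurable.coe_nnreal_ennreal
        (by filter_upwards [hpos] with y hy; simpa using hy.ne')
    have hfv : AEMeasurable f volume := (hf.mono_ac hac).aemeasurable
    have hgm : AEMeasurable (fun x => f x / (dualWeight p w x : ℝ)) volume :=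
      hfv.div hσ.aemeasurable.coe_nnreal_real
    have hg := hC _ _ (isYoung_rpow hp') (isYoung_rpow hp.le) hinv w (dualWeight p w) hσ
      (fun x => f x / (dualWeight p w x : ℝ))
      (hgm.aestronglyMeasurable.mono_ac (withDensity_absolutelyContinuous _ _))
    have hmax : maxPlus (fun x => f x / (dualWeight p w x : ℝ) * (dualWeight p w x : ℝ)) =
        maxPlus f := by
      rw [maxPlus_eq_maxMeas, maxPlus_eq_maxMeas]
      congr 1
      refine withDensity_congr_ae ?_
      filter_upwards [hpos] with x hx
      have : (dualWeight p w x : ℝ) ≠ 0 := by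
        exact_mod_cast (NNReal.rpow_pos hx).ne'
      rw [div_mul_cancel₀ _ this]
    have hnorm : eLpNorm (fun x => f x / (dualWeight p w x : ℝ)) (ENNReal.ofReal p)
        (weightMeasure (dualWeight p w)) = eLpNorm f (ENNReal.ofReal p) (weightMeasure w) := by
      have hpe : ENNReal.ofReal p ≠ 0 := by simpa using hp0
      rw [eLpNorm_eq_lintegral_rpow_enorm_toReal hpe ENNReal.ofReal_ne_top,
        eLpNorm_eq_lintegral_rpow_enorm_toReal hpe ENNReal.ofReal_ne_top,
        ENNReal.toReal_ofReal hp0.le, lintegral_div_dualWeight hp hw hpos hfv]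
    rw [hmax, hnorm] at hg
    refine hg.trans ?_
    rw [mul_comm (apPlusConst p w)]
    gcongr
    · exact wMinusConst_rpow_le hp0 _
    · exact bumpConst_rpow_le hp w
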